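/- **Setting.** Let $f$ be a probability density on $[0,\infty)$ with distribution function $F$, and let $\psi(c)=c+F(c)/f(c)$ be the virtual cost ($\psi(c)=\infty$ where $f(c)=0$). Assume that $\psi$ is strictly increasing on $\{f>0\}$ and that there are $c_1>0$ and $0<r_1\le r_2<\infty$ with $r_1\le f\le r_2$ on $[0,c_1]$. Let $\gamma,\beta>0$. Let $\mathcal D$ be a distribution of data points $(x,y)\in\mathbb R^n\times\{\pm1\}$ with $\|x\|\le 1$. For each $m$, the data set $D=((x^i,y^i))_{i\le m}$ is iid from $\mathcal D$, the privacy sensitivities $c=(c_i)_{i\le m}$ are iid with density $f$, the noise vector $b\in\mathbb R^n$ has $\|b\|\sim\Gamma(n,1)$ and an independent, uniformly distributed direction, and $D$, $c$, $b$ are independent. Assume that for some $\rho>0$ the data sets are almost surely linearly separable with margin $\rho$: there is $w^*$ with $\|w^*\|=1$ and $y^i\langle w^*,x^i\rangle\ge\rho$ for all $i\le m$. Below $\ln$ is the natural logarithm and $\log=\log_2$. **Mechanism.** For weights $\mu,\sigma>0$: 1. $(\hat a,\hat\eta)=(\hat a(c),\hat\eta(c))$ is a (measurably chosen) minimizer of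 $\mu\|a\|+\sigma/\eta+\gamma\sum_i\eta a_i\psi(c_i)$ over $a\ge 0$, $\sum_i a_i=1$, $\eta>0$ (with $0\cdot\infty=0$). The privacy levels are $\hat\epsilon_i(c)=\hat a_i\hat\eta$. 2. The payments are $\hat t_i(c)=-\int_{c_i}^\infty z\,\frac{d}{dz}\hat\epsilon_i(c_{-i},z)\,dz$, where $d/dz$ is either the pointwise derivative or the Stieltjes differential; in the second reading $\hat t_i(c)=c_i\hat\epsilon_i(c)+\int_{c_i}^\infty\hat\epsilon_i(c_{-i},z)\,dz$. 3. $\hat w$ minimizes $\sum_i\hat a_i\log(1+e^{-y^i\langle w,x^i\rangle})+\frac{2\langle b,w\rangle}{\hat\eta}+\frac{\Lambda}{2}\|w\|^2$ over $w\in\mathbb R^n$, where $\Lambda>0$ (which may depend on the realization) is such that $\|\hat w\|=\beta$. The weights are $\mu(\delta,\beta)=\frac{3\ln(1/\delta)}{\sqrt2}\log(1+e^\beta)+\frac{\beta}{\ln2}$ and $\sigma(\delta,\delta',\beta)=\big(\frac{6\ln(1/\delta)}{\sqrt2}+1\big)\,2\beta\,v^{-1}(\delta')$ with $v(t)=\sum_{i=0}^{n-1}\frac{(t/2)^i}{i!}e^{-t/2}$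 on $[0,\infty)$. The buyer's objective is $J_m=\mathbb P_{(x,y)\sim\mathcal D}[\operatorname{sign}\langle\hat w,x\rangle\ne y]+\gamma\sum_i\hat t_i(c)$. **Theorem.** There is a constant $E>0$, depending only on $f,\gamma,\beta$, such that for every $\nu>0$ the following holds. For $m\ge1$ take $\delta_m=\exp(-E\nu m^{1/4})$; there is $\delta'_m\in(0,1)$ with $\sigma(\delta_m,\delta'_m,\beta)=\mu(\delta_m,\beta)^2$. With these weights, there are a sequence $r_m\to0$ and a constant $C$, neither of which depends on the choice of minimizers in step 1, such that for all $m\ge1$, outside an event of (outer) probability at most $C\exp\!\big(-\nu\frac{m^{1/4}}{2\beta}\big)$, an output $\hat w$ with $\|\hat w\|=\beta$ exists, and every such output satisfies $J_m<\log(1+e^{-\rho\beta})+\nu+r_m$. In particular $$\mathbb P\big(J_m\ge\log(1+e^{-\rho\beta})+\nu+o(1)\big)\le O\!\big(e^{-\nu m^{1/4}/(2\beta)}\big).$$ -/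

import Mathlib

open MeasureTheory ProbabilityTheory Filter Topology
open scoped RealInnerProductSpace

noncomputable section

namespace PrivateMarket

/-- The feature space with the Euclidean norm. -/
abbrev Feature (n : ℕ) := EuclideanSpace ℝ (Fin n)

/-- A data point `(x, y)`; labels are real numbers, required to be `1` or `-1` almost surely. -/
abbrev DataPoint (n : ℕ) := Feature n × ℝ

/-! ### Privacy sensitivities -/

/-- `f` is a probability density on `[0, ∞)`. -/
structure IsCostDensity (f : ℝ → ℝ) : Prop where
  measurable : Measurable f
  nonneg : ∀ c, 0 ≤ f c
  zero_of_neg : ∀ c, c < 0 → f c = 0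
  lintegral_eq_one : ∫⁻ c, ENNReal.ofReal (f c) = 1

/-- The law of one privacy sensitivity. -/
def costLaw (f : ℝ → ℝ) : Measure ℝ :=
  volume.withDensity fun c => ENNReal.ofReal (f c)

/-- The virtual cost `ψ(c) = c + F(c) / f(c)`, with `F` the distribution function of the density
`f`. It is meaningful where `f c ≠ 0`; where `f` vanishes the virtual cost is infinite, which is
taken into account in `feasible`. -/
def virtualCost (f : ℝ → ℝ) (c : ℝ) : ℝ :=
  c + (costLaw f).real (Set.Iic c) / f c

/-- The density is bounded, and bounded away from zero, on an interval `[0, c₁]`. -/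
def PositiveBoundedNearZero (f : ℝ → ℝ) : Prop :=
  ∃ c₁ > 0, ∃ r₁ > 0, ∃ r₂, ∀ c ∈ Set.Icc (0 : ℝ) c₁, r₁ ≤ f c ∧ f c ≤ r₂

/-- Regularity: the virtual cost is strictly increasing (where it is finite). -/
def RegularVirtualCost (f : ℝ → ℝ) : Prop :=
  StrictMonoOn (virtualCost f) {c | 0 < f c}

/-! ### Noise -/

/-- The uniform distribution on the unit sphere. -/
def uniformSphere (n : ℕ) : Measure (Metric.sphere (0 : Feature n) 1) :=
  ((volume : Measure (Feature n)).toSphere Set.univ)⁻¹ • (volume : Measure (Feature n)).toSphere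

/-- The law of the noise `b`: its norm is `Γ(n, 1)` distributed, and its direction is uniform and
independent of the norm. -/
def noiseLaw (n : ℕ) : Measure (Feature n) :=
  ((gammaMeasure (n : ℝ) 1).prod (uniformSphere n)).map fun p => p.1 • (p.2 : Feature n)

/-- The joint law of the `m` data points (iid from `𝒟`), the `m` privacy sensitivities
(iid with density `f`) and the noise `b`, all independent. -/
def sampleLaw {n : ℕ} (𝒟 : Measure (DataPoint n)) (f : ℝ → ℝ) (m : ℕ) :
    Measure ((Fin m → DataPoint n) × (Fin m → ℝ) × Feature n) :=
  (Measure.pi fun _ => 𝒟).prod ((Measure.pi fun _ => costLaw f).prod (noiseLaw n))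

/-! ### Step 1: privacy levels -/

/-- Admissible pairs `(a, η)`. A seller whose report has density zero has infinite virtual cost,
so that the weight must vanish. -/
def feasible (f : ℝ → ℝ) {m : ℕ} (c : Fin m → ℝ) : Set ((Fin m → ℝ) × ℝ) :=
  {p | (∀ i, 0 ≤ p.1 i) ∧ ∑ i, p.1 i = 1 ∧ 0 < p.2 ∧ ∀ i, f (c i) = 0 → p.1 i = 0}

/-- `μ ‖a‖ + σ / η + γ ∑ i, η a i ψ(c i)` at `p = (a, η)`. -/
def proxyLoss (f : ℝ → ℝ) (μ σ γ : ℝ) {m : ℕ} (c : Fin m → ℝ) (p : (Fin m → ℝ) × ℝ) : ℝ :=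
  μ * √(∑ i, p.1 i ^ 2) + σ / p.2 + γ * ∑ i, p.2 * p.1 i * virtualCost f (c i)

/-- `p = (a, η)` minimizes the proxy loss over the admissible pairs. -/
def IsStepOneSolution (f : ℝ → ℝ) (μ σ γ : ℝ) {m : ℕ} (c : Fin m → ℝ)
    (p : (Fin m → ℝ) × ℝ) : Prop :=
  p ∈ feasible f c ∧ IsMinOn (proxyLoss f μ σ γ c) (feasible f c) p

/-- `alloc` maps every vector of reports `c` to a minimizer `(a, η)` of the proxy loss (whenever
there is one), in a measurable way. -/
structure IsStepOneRule (f : ℝ → ℝ) (μ σ γ : ℝ) {m : ℕ}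
    (alloc : (Fin m → ℝ) → (Fin m → ℝ) × ℝ) : Prop where
  measurable : Measurable alloc
  isSolution : ∀ c, (∃ p, IsStepOneSolution f μ σ γ c p) → IsStepOneSolution f μ σ γ c (alloc c)

/-- The privacy level `ε i = a i * η` of seller `i`. -/
def privacyLevel {m : ℕ} (alloc : (Fin m → ℝ) → (Fin m → ℝ) × ℝ) (c : Fin m → ℝ) (i : Fin m) :
    ℝ :=
  (alloc c).1 i * (alloc c).2

/-! ### Step 2: payments -/

/-- The payments `- ∫_{c i}^∞ z (d/dz ε i (c₋ᵢ, z)) dz`, with the pointwise derivative. -/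
def payment {m : ℕ} (alloc : (Fin m → ℝ) → (Fin m → ℝ) × ℝ) (c : Fin m → ℝ) (i : Fin m) : ℝ :=
  -∫ z in Set.Ioi (c i), z * deriv (fun s => privacyLevel alloc (Function.update c i s) i) z

/-- The same payments integrated by parts, `c i * ε i (c) + ∫_{c i}^∞ ε i (c₋ᵢ, z) dz`. This is the
value of the payment integral when `d/dz ε i` is read as a Stieltjes differential, so that jumps
of `ε i` as a function of the report of seller `i` are counted. -/
def paymentByParts {m : ℕ} (alloc : (Fin m → ℝ) → (Fin m → ℝ) × ℝ) (c : Fin m → ℝ) (i : Fin m) :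
    ℝ :=
  c i * privacyLevel alloc c i +
    ∫ z in Set.Ioi (c i), privacyLevel alloc (Function.update c i z) i

/-- `t` is the payment rule that belongs to the privacy levels, in either of the two readings
(they agree if the privacy levels are absolutely continuous in the report). -/
def IsPaymentRule {m : ℕ} (alloc : (Fin m → ℝ) → (Fin m → ℝ) × ℝ)
    (t : (Fin m → ℝ) → Fin m → ℝ) : Prop :=
  t = payment alloc ∨ t = paymentByParts alloc

/-! ### Step 3: private logistic regression -/

/-- The logistic loss, with the logarithm to base two. -/
def logisticLoss (z : ℝ) : ℝ := Real.logb 2 (1 + Real.exp (-z))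

/-- The regularized, weighted and perturbed empirical loss, at `p = (a, η)`. -/
def trainingObjective {n m : ℕ} (D : Fin m → DataPoint n) (p : (Fin m → ℝ) × ℝ) (b : Feature n)
    (Λ : ℝ) (w : Feature n) : ℝ :=
  ∑ i, p.1 i * logisticLoss ((D i).2 * ⟪w, (D i).1⟫) + 2 * ⟪b, w⟫ / p.2 + Λ / 2 * ‖w‖ ^ 2

/-- `w` is the output of the regression step for some regularization parameter `Λ > 0` that makes
its norm equal to `β`. -/
def IsTunedOutput {n m : ℕ} (D : Fin m → DataPoint n) (p : (Fin m → ℝ) × ℝ) (b : Feature n)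
    (β : ℝ) (w : Feature n) : Prop :=
  (∃ Λ > 0, ∀ u, trainingObjective D p b Λ w ≤ trainingObjective D p b Λ u) ∧ ‖w‖ = β

/-- The buyer's objective: misclassification probability of `w` under `𝒟`, plus `γ` times the sum
of the payments. -/
def buyerObjective {n m : ℕ} (𝒟 : Measure (DataPoint n)) (γ : ℝ) (w : Feature n)
    (t : Fin m → ℝ) : ℝ :=
  𝒟.real {z | Real.sign ⟪w, z.1⟫ ≠ z.2} + γ * ∑ i, t i

/-! ### Data -/

/-- Features in the unit ball and labels `±1`, almost surely. -/
def IsDataLaw {n : ℕ} (𝒟 : Measure (DataPoint n)) : Prop :=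
  ∀ᵐ z ∂𝒟, ‖z.1‖ ≤ 1 ∧ (z.2 = 1 ∨ z.2 = -1)

/-- Every (almost every) data set is linearly separable with margin `ρ`. -/
def SeparableWithMargin {n : ℕ} (𝒟 : Measure (DataPoint n)) (ρ : ℝ) : Prop :=
  ∀ m : ℕ, ∀ᵐ D ∂(Measure.pi fun _ : Fin m => 𝒟),
    ∃ w : Feature n, ‖w‖ = 1 ∧ ∀ i, ρ ≤ ⟪w, (D i).1⟫ * (D i).2

/-! ### Hyperparameters -/

/-- `v(t) = ∑_{i < n} (t/2)^i / i! * e^{-t/2}`. -/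
def gammaTail (n : ℕ) (t : ℝ) : ℝ :=
  ∑ i ∈ Finset.range n, (t / 2) ^ i / (i.factorial : ℝ) * Real.exp (-(t / 2))

/-- The inverse of the decreasing bijection `v : [0, ∞) → (0, 1]`. -/
def gammaTailInv (n : ℕ) (s : ℝ) : ℝ :=
  Function.invFunOn (gammaTail n) (Set.Ici 0) s

/-- The weight `μ(δ, β)`. -/
def muParam (δ β : ℝ) : ℝ :=
  3 * Real.log (1 / δ) / √2 * Real.logb 2 (1 + Real.exp β) + β / Real.log 2

/-- The weight `σ(δ, δ', β)`. -/
def sigmaParam (n : ℕ) (δ δ' β : ℝ) : ℝ :=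
  (6 * Real.log (1 / δ) / √2 + 1) * (2 * β * gammaTailInv n δ')

end PrivateMarket

end

open PrivateMarket

/-!
The regularization weights grow like `μ ~ ν m ^ (1/4)` and `σ = μ ^ 2`. Write `h = m ^ (1/4)`.
About `h ^ 2` of the `h ^ 4` sellers report less than `h⁻²`, up to constants, outside an event of
probability `exp (-κ h ^ 2)` (Chernoff). On the complement, everything about the allocation is
deterministic. Comparison with uniform weights on those sellers bounds the optimal proxy loss by
`B μ / h`, hence `‖a‖ ≤ B / h` and `η ≥ μ h / B`; a perturbation argument shows that no seller with a
report above a constant times `h⁻²` is active (`stepOne_bounds`). Since the weights are spread out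
and few sellers are much cheaper than `h⁻²`, `η` is at most a constant times `μ h`
(`eta_le_of_typical`).

The bounds are stable under the change of one report, and near zero the privacy level falls with the
report. So each payment, in either reading, is at most the largest active report times the privacy
level, and the payments add up to at most a constant times `μ / h` (`sum_payment_le`). This tends to
a constant times `E ν`, which is why `E` can be chosen independently of `ν`.

The regression step has a slack of a power of `h`. If `‖b‖ ≤ ν h / β`, which fails with probability
at most `2 ^ n exp (-ν h / (2 β))`, the noise terms are `O(1 / h)`; then the loss decreases in the
direction of the separating vector all over the ball of radius `β`, so that its minimizer over the
ball lies on the sphere and is a tuned output (`exists_isTunedOutput`). Any tuned output has a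
training loss of at most `log (1 + exp (-ρ β))` plus noise (`trainingLoss_le`). Conditionally on the
reports, Hoeffding's inequality with `‖a‖ ≤ B / h` on a finite net of the ball
(`weighted_risk_tail`, `risk_le_of_net`) carries this over to the expected logistic loss, which
dominates the misclassification probability. All estimates hold for large `m`, and the constant `C`
takes care of the remaining values of `m`.
-/

namespace PrivateMarket

section

/-! ### The virtual cost -/

theorem le_virtualCost {f : ℝ → ℝ} (hf : ∀ c, 0 ≤ f c) (c : ℝ) : c ≤ virtualCost f c :=
  le_add_of_nonneg_right (div_nonneg measureReal_nonneg (hf c))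

theorem costLaw_real_Iic_le {f : ℝ → ℝ} (hf : IsCostDensity f) {c₁ r₂ : ℝ}
    (h₂ : ∀ c ∈ Set.Icc (0 : ℝ) c₁, f c ≤ r₂) {c : ℝ} (hc : c ∈ Set.Icc (0 : ℝ) c₁) :
    (costLaw f).real (Set.Iic c) ≤ r₂ * c := by
  have hr : 0 ≤ r₂ := (hf.nonneg c).trans (h₂ c hc)
  refine ENNReal.toReal_le_of_le_ofReal (mul_nonneg hr hc.1) ?_
  rw [costLaw, withDensity_apply _ measurableSet_Iic]
  calc ∫⁻ a in Set.Iic c, ENNReal.ofReal (f a)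
      ≤ ∫⁻ a in Set.Iic c, (Set.Icc 0 c).indicator (fun _ => ENNReal.ofReal r₂) a := by
        refine setLIntegral_mono' measurableSet_Iic fun a ha => ?_
        by_cases h0 : 0 ≤ a
        · rw [Set.indicator_of_mem (show a ∈ Set.Icc 0 c from ⟨h0, ha⟩)]
          exact ENNReal.ofReal_le_ofReal (h₂ a ⟨h0, le_trans ha hc.2⟩)
        · simp [hf.zero_of_neg a (not_le.1 h0)]
    _ ≤ ∫⁻ a, (Set.Icc 0 c).indicator (fun _ => ENNReal.ofReal r₂) a := setLIntegral_le_lintegral _ _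
    _ = ENNReal.ofReal (r₂ * c) := by
        rw [lintegral_indicator measurableSet_Icc, setLIntegral_const, Real.volume_Icc, sub_zero,
          ENNReal.ofReal_mul hr]

theorem le_costLaw_real_Iic {f : ℝ → ℝ} (hf : IsCostDensity f) {c₁ r₁ : ℝ} (hr : 0 ≤ r₁)
    (h₁ : ∀ c ∈ Set.Icc (0 : ℝ) c₁, r₁ ≤ f c) {c : ℝ} (hc : c ∈ Set.Icc (0 : ℝ) c₁) :
    r₁ * c ≤ (costLaw f).real (Set.Iic c) := by
  have hfin : costLaw f (Set.Iic c) ≠ ⊤ := by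
    refine ne_top_of_le_ne_top ENNReal.one_ne_top ((measure_mono (Set.subset_univ _)).trans ?_)
    rw [costLaw, withDensity_apply _ MeasurableSet.univ, setLIntegral_univ, hf.lintegral_eq_one]
  refine (ENNReal.ofReal_le_iff_le_toReal hfin).1 ?_
  calc ENNReal.ofReal (r₁ * c) = ∫⁻ _ in Set.Icc 0 c, ENNReal.ofReal r₁ := by
        rw [setLIntegral_const, Real.volume_Icc, sub_zero, ENNReal.ofReal_mul hr]
    _ ≤ ∫⁻ a in Set.Icc 0 c, ENNReal.ofReal (f a) := by
        refine setLIntegral_mono' measurableSet_Icc fun a ha => ?_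
        exact ENNReal.ofReal_le_ofReal (h₁ a ⟨ha.1, ha.2.trans hc.2⟩)
    _ = costLaw f (Set.Icc 0 c) := (withDensity_apply _ measurableSet_Icc).symm
    _ ≤ costLaw f (Set.Iic c) := measure_mono Set.Icc_subset_Iic_self

theorem virtualCost_le {f : ℝ → ℝ} (hf : IsCostDensity f) {c₁ r₁ r₂ : ℝ} (hr : 0 < r₁)
    (h : ∀ c ∈ Set.Icc (0 : ℝ) c₁, r₁ ≤ f c ∧ f c ≤ r₂) {c : ℝ}
    (hc : c ∈ Set.Icc (0 : ℝ) c₁) : virtualCost f c ≤ c * (1 + r₂ / r₁) := by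
  have hF := costLaw_real_Iic_le hf (fun c hc => (h c hc).2) hc
  have h2 : 0 ≤ r₂ := (hf.nonneg c).trans (h c hc).2
  have : (costLaw f).real (Set.Iic c) / f c ≤ r₂ * c / r₁ :=
    div_le_div₀ (mul_nonneg h2 hc.1) hF hr (h c hc).1
  calc virtualCost f c ≤ c + r₂ * c / r₁ := by unfold virtualCost; gcongr
    _ = c * (1 + r₂ / r₁) := by ring

/-! ### Minimizers of the proxy loss -/

variable {f : ℝ → ℝ} {μ σ γ : ℝ} {m : ℕ} {c : Fin m → ℝ} {p : (Fin m → ℝ) × ℝ}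

theorem cost_sum_nonneg (hf : ∀ c, 0 ≤ f c) (hc : ∀ i, 0 ≤ c i) (hp : p ∈ feasible f c) :
    0 ≤ ∑ i, p.1 i * virtualCost f (c i) :=
  Finset.sum_nonneg fun i _ => mul_nonneg (hp.1 i) ((hc i).trans (le_virtualCost hf _))

theorem proxyLoss_eq : proxyLoss f μ σ γ c p =
    μ * √(∑ i, p.1 i ^ 2) + σ / p.2 + γ * p.2 * ∑ i, p.1 i * virtualCost f (c i) := by
  simp only [proxyLoss, Finset.mul_sum, mul_assoc]

theorem weight_le_one (hp : p ∈ feasible f c) (i : Fin m) : p.1 i ≤ 1 :=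
  hp.2.1 ▸ Finset.single_le_sum (fun j _ => hp.1 j) (Finset.mem_univ i)

theorem norm_add_inv_le_proxyLoss (hf : ∀ c, 0 ≤ f c) (hγ : 0 ≤ γ) (hc : ∀ i, 0 ≤ c i)
    (hp : p ∈ feasible f c) : μ * √(∑ i, p.1 i ^ 2) + σ / p.2 ≤ proxyLoss f μ σ γ c p := by
  rw [proxyLoss_eq]
  exact le_add_of_nonneg_right (mul_nonneg (mul_nonneg hγ hp.2.2.1.le) (cost_sum_nonneg hf hc hp))

/-- A seller with positive weight has a small virtual cost: taking half of the privacy level away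
from that seller must not pay off. -/
theorem virtualCost_mul_le_of_pos (hf : ∀ c, 0 ≤ f c) (hμ : 0 ≤ μ) (hσ : 0 ≤ σ) (hγ : 0 ≤ γ)
    (hc : ∀ i, 0 ≤ c i) (hp : IsStepOneSolution f μ σ γ c p) {i : Fin m} (hi : 0 < p.1 i) :
    γ * virtualCost f (c i) * p.2 ≤ 2 * proxyLoss f μ σ γ c p := by
  obtain ⟨hpf, hmin⟩ := hp
  have hη := hpf.2.2.1
  set s : ℝ := p.1 i * p.2 / 2 with hs
  have hs0 : 0 < s := by positivity
  have hs1 : s ≤ p.2 / 2 := by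
    have := weight_le_one hpf i
    rw [hs]; gcongr; nlinarith
  have hη' : 0 < p.2 - s := by linarith
  let e : Fin m → ℝ := Pi.single i s
  let q : (Fin m → ℝ) × ℝ := (fun j => (p.1 j * p.2 - e j) / (p.2 - s), p.2 - s)
  have he0 : ∀ j, 0 ≤ e j := fun j => by
    rcases eq_or_ne j i with rfl | h
    · simpa [e] using hs0.le
    · simp [e, h]
  have hes : ∑ j, e j = s := by simp [e]
  have hq0 : ∀ j, 0 ≤ p.1 j * p.2 - e j := fun j => by
    rcases eq_or_ne j i with rfl | h
    · simp only [e, Pi.single_eq_same, hs]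
      have : 0 ≤ p.1 j * p.2 := by positivity
      linarith
    · simpa [e, h] using mul_nonneg (hpf.1 j) hη.le
  have hq : q ∈ feasible f c := by
    refine ⟨fun j => div_nonneg (hq0 j) hη'.le, ?_, hη', fun j hj => ?_⟩
    · simp only [q]
      rw [← Finset.sum_div, Finset.sum_sub_distrib, ← Finset.sum_mul, hpf.2.1, hes, one_mul,
        div_self hη'.ne']
    · have hji : j ≠ i := by rintro rfl; exact hi.ne' (hpf.2.2.2 j hj)
      simp [q, e, hji, hpf.2.2.2 j hj]
  have hnorm : √(∑ j, q.1 j ^ 2) ≤ √(∑ j, p.1 j ^ 2) * (p.2 / (p.2 - s)) := by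
    rw [← Real.sqrt_sq (show 0 ≤ p.2 / (p.2 - s) by positivity),
      ← Real.sqrt_mul (Finset.sum_nonneg fun j _ => sq_nonneg _), Finset.sum_mul]
    refine Real.sqrt_le_sqrt (Finset.sum_le_sum fun j _ => ?_)
    rw [← mul_pow]
    refine pow_le_pow_left₀ (div_nonneg (hq0 j) hη'.le) ?_ 2
    rw [mul_div_assoc']
    exact div_le_div_of_nonneg_right (sub_le_self _ (he0 j)) hη'.le
  have hcost : q.2 * ∑ j, q.1 j * virtualCost f (c j) =
      p.2 * (∑ j, p.1 j * virtualCost f (c j)) - s * virtualCost f (c i) := by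
    have h1 : s * virtualCost f (c i) = ∑ j, e j * virtualCost f (c j) := by
      rw [Finset.sum_eq_single i]
      · simp [e]
      · intro j _ hj; simp [e, hj]
      · simp
    rw [h1, Finset.mul_sum, Finset.mul_sum, ← Finset.sum_sub_distrib]
    refine Finset.sum_congr rfl fun j _ => ?_
    simp only [q]
    field_simp
  have hle := hmin hq
  simp only [Set.mem_ofPred_eq, proxyLoss_eq] at hle
  have h1 := norm_add_inv_le_proxyLoss (μ := μ) (σ := σ) hf hγ hc hpf
  set A := μ * √(∑ i, p.1 i ^ 2) + σ / p.2 with hA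
  have hA0 : 0 ≤ A := by positivity
  rw [mul_assoc γ q.2, hcost, mul_assoc γ p.2] at hle
  have h2 : μ * √(∑ j, q.1 j ^ 2) + σ / q.2 ≤ A * (p.2 / (p.2 - s)) := by
    have : σ / q.2 = σ / p.2 * (p.2 / (p.2 - s)) := by simp only [q]; field_simp
    rw [this, hA, add_mul, mul_assoc μ]
    gcongr
  have h3 : γ * (s * virtualCost f (c i)) ≤ A * (s / (p.2 - s)) := by
    have : A * (s / (p.2 - s)) = A * (p.2 / (p.2 - s)) - A := by field_simp; ring
    rw [this]; nlinarith
  have h4 : γ * virtualCost f (c i) ≤ A / (p.2 - s) := by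
    rw [← mul_le_mul_iff_right₀ hs0]
    calc s * (γ * virtualCost f (c i)) = γ * (s * virtualCost f (c i)) := by ring
      _ ≤ _ := h3
      _ = _ := by ring
  rw [le_div_iff₀ hη'] at h4
  have h5 : 0 ≤ γ * virtualCost f (c i) :=
    mul_nonneg hγ ((hc i).trans (le_virtualCost hf _))
  nlinarith

/-- The optimal level `η` cannot be much larger than where `σ / η` and the expected cost balance:
otherwise halving it would pay off. -/
theorem cost_mul_sq_le (hp : IsStepOneSolution f μ σ γ c p) :
    γ * (∑ i, p.1 i * virtualCost f (c i)) * p.2 ^ 2 ≤ 2 * σ := by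
  obtain ⟨hpf, hmin⟩ := hp
  have hη := hpf.2.2.1
  have hq : ((p.1, p.2 / 2) : (Fin m → ℝ) × ℝ) ∈ feasible f c :=
    ⟨hpf.1, hpf.2.1, half_pos hη, hpf.2.2.2⟩
  have hle := hmin hq
  simp only [Set.mem_ofPred_eq, proxyLoss_eq] at hle
  set S := ∑ i, p.1 i * virtualCost f (c i)
  have e : σ / (p.2 / 2) = 2 * (σ / p.2) := by field_simp
  rw [e] at hle
  have h : γ * S * p.2 ≤ 2 * (σ / p.2) := by nlinarith
  calc γ * S * p.2 ^ 2 = γ * S * p.2 * p.2 := by ring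
    _ ≤ 2 * (σ / p.2) * p.2 := by gcongr
    _ = 2 * σ := by field_simp

/-- The privacy level of a seller can only fall when the reported virtual cost rises, whatever the
minimizers are: add the two optimality conditions. -/
theorem privacy_le_of_virtualCost_lt (hγ : 0 < γ) {c' : Fin m → ℝ} {q : (Fin m → ℝ) × ℝ}
    {i : Fin m} (hcc : ∀ j, j ≠ i → c' j = c j) (h0 : f (c i) ≠ 0) (h0' : f (c' i) ≠ 0)
    (hlt : virtualCost f (c i) < virtualCost f (c' i))
    (hp : IsStepOneSolution f μ σ γ c p) (hq : IsStepOneSolution f μ σ γ c' q) :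
    q.1 i * q.2 ≤ p.1 i * p.2 := by
  have hfeas : feasible f c' = feasible f c := by
    ext r
    have : (∀ j, f (c' j) = 0 → r.1 j = 0) ↔ ∀ j, f (c j) = 0 → r.1 j = 0 := by
      refine forall_congr' fun j => ?_
      rcases eq_or_ne j i with rfl | h
      · simp [h0, h0']
      · rw [hcc j h]
    simp only [feasible, Set.mem_ofPred_eq, this]
  have hdiff : ∀ r : (Fin m → ℝ) × ℝ, proxyLoss f μ σ γ c' r =
      proxyLoss f μ σ γ c r + γ * (r.1 i * r.2) * (virtualCost f (c' i) - virtualCost f (c i)) := by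
    intro r
    have : ∑ j, r.2 * r.1 j * virtualCost f (c' j) - ∑ j, r.2 * r.1 j * virtualCost f (c j) =
        r.2 * r.1 i * (virtualCost f (c' i) - virtualCost f (c i)) := by
      rw [← Finset.sum_sub_distrib, Finset.sum_eq_single i]
      · ring
      · intro j _ hj; rw [hcc j hj]; ring
      · simp
    unfold proxyLoss
    linear_combination γ * this
  have h1 := hp.2 (hfeas ▸ hq.1)
  have h2 := hq.2 (hfeas ▸ hp.1)
  simp only [Set.mem_ofPred_eq, hdiff] at h1 h2
  by_contra! h
  have : 0 < γ * (virtualCost f (c' i) - virtualCost f (c i)) := mul_pos hγ (sub_pos.2 hlt)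
  nlinarith

/-- Comparison with the uniform weights on a set of cheap sellers. -/
theorem proxyLoss_le_of_cheap (hμ : 0 ≤ μ) (hγ : 0 ≤ γ) (hp : IsStepOneSolution f μ σ γ c p)
    {S : Finset (Fin m)} (hS : S.Nonempty) {η v k : ℝ} (hη : 0 < η) (hk : 0 < k)
    (hkS : k ≤ S.card) (h0 : ∀ i ∈ S, f (c i) ≠ 0)
    (hv : ∀ i ∈ S, virtualCost f (c i) ≤ v) :
    proxyLoss f μ σ γ c p ≤ μ / √k + σ / η + γ * η * v := by
  have hS0 : (0 : ℝ) < S.card := by exact_mod_cast hS.card_pos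
  let q : (Fin m → ℝ) × ℝ := (fun i => if i ∈ S then (S.card : ℝ)⁻¹ else 0, η)
  have hq : q ∈ feasible f c := by
    refine ⟨fun i => ?_, ?_, hη, fun i hi => ?_⟩
    · simp only [q]; split_ifs <;> positivity
    · simp only [q]
      rw [Finset.sum_ite_mem, Finset.univ_inter, Finset.sum_const, nsmul_eq_mul,
        mul_inv_cancel₀ hS0.ne']
    · simp only [q]
      rw [if_neg fun h => h0 i h hi]
  have hle := hp.2 hq
  simp only [Set.mem_ofPred_eq] at hle
  refine hle.trans ?_
  rw [proxyLoss_eq]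
  have h1 : √(∑ i, q.1 i ^ 2) ≤ 1 / √k := by
    rw [← Real.sqrt_one, ← Real.sqrt_div zero_le_one]
    refine Real.sqrt_le_sqrt ?_
    have : ∑ i, q.1 i ^ 2 = 1 / S.card := by
      simp only [q, ite_pow]
      rw [zero_pow two_ne_zero, Finset.sum_ite_mem, Finset.univ_inter, Finset.sum_const,
        nsmul_eq_mul]
      field_simp
    rw [this]
    exact one_div_le_one_div_of_le hk hkS
  have h2 : ∑ i, q.1 i * virtualCost f (c i) ≤ v := by
    have : ∑ i, q.1 i * virtualCost f (c i) = ∑ i ∈ S, (S.card : ℝ)⁻¹ * virtualCost f (c i) := by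
      simp only [q, ite_mul, zero_mul]
      rw [Finset.sum_ite_mem, Finset.univ_inter]
    rw [this]
    calc ∑ i ∈ S, (S.card : ℝ)⁻¹ * virtualCost f (c i) ≤ ∑ i ∈ S, (S.card : ℝ)⁻¹ * v :=
          Finset.sum_le_sum fun i hi => by have := hv i hi; gcongr
      _ = v := by rw [Finset.sum_const, nsmul_eq_mul]; field_simp
  calc μ * √(∑ i, q.1 i ^ 2) + σ / q.2 + γ * q.2 * ∑ i, q.1 i * virtualCost f (c i)
      ≤ μ * (1 / √k) + σ / η + γ * η * v := by gcongr
    _ = _ := by ring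

/-- Positive reports keep `η` bounded, so that the search for a minimizer is over a compact set. -/
theorem exists_isStepOneSolution (hf : ∀ c, 0 ≤ f c) (hμ : 0 ≤ μ) (hσ : 0 < σ) (hγ : 0 < γ)
    (hc : ∀ i, 0 < c i) (h0 : ∃ i, f (c i) ≠ 0) : ∃ p, IsStepOneSolution f μ σ γ c p := by
  obtain ⟨i₀, hi₀⟩ := h0
  have hne : (Finset.univ : Finset (Fin m)).Nonempty := ⟨i₀, Finset.mem_univ _⟩
  obtain ⟨j₀, -, hj₀⟩ := Finset.exists_min_image Finset.univ c hne
  let q₀ : (Fin m → ℝ) × ℝ := (Pi.single i₀ 1, 1)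
  have hq₀ : q₀ ∈ feasible f c := by
    refine ⟨fun j => ?_, ?_, one_pos, fun j hj => ?_⟩
    · rcases eq_or_ne j i₀ with rfl | h <;> simp [q₀, *]
    · simp [q₀]
    · have : j ≠ i₀ := by rintro rfl; exact hi₀ hj
      simp [q₀, this]
  set L := proxyLoss f μ σ γ c q₀ with hL
  have hL0 : 0 < L := by
    refine lt_of_lt_of_le ?_ (norm_add_inv_le_proxyLoss hf hγ.le (fun i => (hc i).le) hq₀)
    have : σ / q₀.2 = σ := by simp [q₀]
    rw [this]; positivity
  have key : ∀ p ∈ feasible f c, proxyLoss f μ σ γ c p ≤ L →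
      p.2 ∈ Set.Icc (σ / L) (L / (γ * c j₀)) := by
    intro p hp hpL
    have hη := hp.2.2.1
    constructor
    · have := norm_add_inv_le_proxyLoss (μ := μ) (σ := σ) hf hγ.le (fun i => (hc i).le) hp
      rw [div_le_iff₀ hL0, mul_comm, ← div_le_iff₀ hη]
      have : 0 ≤ μ * √(∑ i, p.1 i ^ 2) := by positivity
      linarith
    · have hS : c j₀ ≤ ∑ i, p.1 i * virtualCost f (c i) := by
        calc c j₀ = ∑ i, p.1 i * c j₀ := by rw [← Finset.sum_mul, hp.2.1, one_mul]
          _ ≤ _ := Finset.sum_le_sum fun i _ => mul_le_mul_of_nonneg_left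
              ((hj₀ i (Finset.mem_univ i)).trans (le_virtualCost hf _)) (hp.1 i)
      rw [le_div_iff₀ (mul_pos hγ (hc j₀))]
      rw [proxyLoss_eq] at hpL
      have : 0 ≤ μ * √(∑ i, p.1 i ^ 2) + σ / p.2 := by positivity
      have h3 : γ * p.2 * c j₀ ≤ γ * p.2 * ∑ i, p.1 i * virtualCost f (c i) := by gcongr
      nlinarith
  let K : Set ((Fin m → ℝ) × ℝ) :=
    {p | (∀ i, 0 ≤ p.1 i) ∧ ∑ i, p.1 i = 1 ∧ (σ / L ≤ p.2 ∧ p.2 ≤ L / (γ * c j₀)) ∧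
      ∀ i, f (c i) = 0 → p.1 i = 0}
  have hKf : K ⊆ feasible f c := fun p hp =>
    ⟨hp.1, hp.2.1, lt_of_lt_of_le (div_pos hσ hL0) hp.2.2.1.1, hp.2.2.2⟩
  have hKc : IsCompact K := by
    refine IsCompact.of_isClosed_subset
      ((isCompact_Icc (a := (0 : Fin m → ℝ)) (b := 1)).prod
        (isCompact_Icc (a := σ / L) (b := L / (γ * c j₀)))) ?_ ?_
    · have k₁ : IsClosed {p : (Fin m → ℝ) × ℝ | ∀ i, 0 ≤ p.1 i} := by
        rw [Set.ofPred_forall]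
        exact isClosed_iInter fun i => isClosed_le continuous_const (by fun_prop)
      have k₂ : IsClosed {p : (Fin m → ℝ) × ℝ | ∑ i, p.1 i = 1} :=
        isClosed_eq (by fun_prop) continuous_const
      have k₃ : IsClosed {p : (Fin m → ℝ) × ℝ | σ / L ≤ p.2} :=
        isClosed_le continuous_const (by fun_prop)
      have k₄ : IsClosed {p : (Fin m → ℝ) × ℝ | p.2 ≤ L / (γ * c j₀)} :=
        isClosed_le (by fun_prop) continuous_const
      have k₅ : IsClosed {p : (Fin m → ℝ) × ℝ | ∀ i, f (c i) = 0 → p.1 i = 0} := by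
        simp only [Set.ofPred_forall]
        exact isClosed_iInter fun i => isClosed_iInter fun _ =>
          isClosed_eq (by fun_prop) continuous_const
      exact k₁.inter (k₂.inter ((k₃.inter k₄).inter k₅))
    · intro p hp
      exact ⟨⟨fun i => hp.1 i, fun i => weight_le_one (hKf hp) i⟩, hp.2.2.1⟩
  have hq₀K : q₀ ∈ K := ⟨hq₀.1, hq₀.2.1, key q₀ hq₀ le_rfl, hq₀.2.2.2⟩
  have hcont : ContinuousOn (proxyLoss f μ σ γ c) K := by
    have hdiv : ContinuousOn (fun p : (Fin m → ℝ) × ℝ => σ / p.2) K :=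
      continuousOn_const.div continuous_snd.continuousOn fun p hp => (hKf hp).2.2.1.ne'
    have h1 : Continuous fun p : (Fin m → ℝ) × ℝ => μ * √(∑ i, p.1 i ^ 2) := by fun_prop
    have h2 : Continuous fun p : (Fin m → ℝ) × ℝ =>
        γ * ∑ i, p.2 * p.1 i * virtualCost f (c i) := by fun_prop
    exact (h1.continuousOn.add hdiv).add h2.continuousOn
  obtain ⟨p, hpK, hpmin⟩ := hKc.exists_isMinOn ⟨q₀, hq₀K⟩ hcont
  refine ⟨p, hKf hpK, fun q hq => ?_⟩
  have hpL : proxyLoss f μ σ γ c p ≤ L := hpmin hq₀K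
  by_cases hqL : proxyLoss f μ σ γ c q ≤ L
  · exact hpmin ⟨hq.1, hq.2.1, key q hq hqL, hq.2.2.2⟩
  · exact hpL.trans (not_le.1 hqL).le

end

/-! ### Payments -/

/-- The payment of a seller, integrated by parts, is at most the largest report at which the seller
is still active, times the privacy level. -/
theorem byParts_le_of_antitoneOn {h : ℝ → ℝ} {c Z : ℝ}
    (hanti : AntitoneOn h (Set.Ici c)) (hZ : ∀ z, c ≤ z → Z < z → h z = 0) :
    c * h c + ∫ z in Set.Ioi c, h z ≤ Z * h c := by
  have hint : ∫ z in Set.Ioi c, h z = ∫ z in Set.Ioc c Z, h z :=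
    (setIntegral_eq_of_subset_of_forall_sdiff_eq_zero measurableSet_Ioi Set.Ioc_subset_Ioi_self
      fun z hz => hZ z (le_of_lt hz.1) (not_le.1 fun h' => hz.2 ⟨hz.1, h'⟩))
  rw [hint]
  rcases le_or_gt c Z with hcZ | hcZ
  · have hbd : ∫ z in Set.Ioc c Z, h z ≤ ∫ _ in Set.Ioc c Z, h c := by
      refine setIntegral_mono_on ?_ (integrableOn_const (by simp)) measurableSet_Ioc
        fun z hz => hanti Set.self_mem_Ici (le_of_lt hz.1) (le_of_lt hz.1)
      exact ((hanti.mono Set.Icc_subset_Ici_self).integrableOn_isCompact isCompact_Icc).mono_set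
        Set.Ioc_subset_Icc_self
    rw [setIntegral_const, smul_eq_mul, Real.volume_real_Ioc_of_le hcZ] at hbd
    linarith
  · rw [Set.Ioc_eq_empty (not_lt.2 hcZ.le), hZ c le_rfl hcZ]
    simp

/-- The same bound for the pointwise derivative, whose integral only misses the jumps. -/
theorem neg_integral_mul_deriv_le_of_antitoneOn {h : ℝ → ℝ} {c Z : ℝ} (hc : 0 ≤ c) (hZ0 : 0 ≤ Z)
    (hanti : AntitoneOn h (Set.Ici c)) (hnn : ∀ z, c ≤ z → 0 ≤ h z)
    (hZ : ∀ z, c ≤ z → Z < z → h z = 0) :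
    -∫ z in Set.Ioi c, z * deriv h z ≤ Z * h c := by
  have hd0 : ∀ z, c < z → deriv h z ≤ 0 := fun z hz => by
    rw [← derivWithin_of_mem_nhds (Ici_mem_nhds hz)]
    exact hanti.derivWithin_nonpos
  have hdZ : ∀ z, c < z → Z < z → deriv h z = 0 := fun z hz hz' => by
    have : h =ᶠ[𝓝 z] fun _ => 0 := by
      filter_upwards [Ioi_mem_nhds hz, Ioi_mem_nhds hz'] with y hy hy'
      exact hZ y (le_of_lt hy) hy'
    rw [this.deriv_eq, deriv_const]
  have hint : ∫ z in Set.Ioi c, z * deriv h z = ∫ z in Set.Ioc c Z, z * deriv h z :=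
    (setIntegral_eq_of_subset_of_forall_sdiff_eq_zero measurableSet_Ioi Set.Ioc_subset_Ioi_self
      fun z hz => by rw [hdZ z hz.1 (not_le.1 fun h' => hz.2 ⟨hz.1, h'⟩), mul_zero])
  rw [hint]
  rcases le_or_gt c Z with hcZ | hcZ
  · have hmono : MonotoneOn (-h) (Set.uIcc c Z) := by
      rw [Set.uIcc_of_le hcZ]
      exact (hanti.mono Set.Icc_subset_Ici_self).neg
    have hI : IntegrableOn (deriv (-h)) (Set.Ioc c Z) :=
      (intervalIntegrable_iff_integrableOn_Ioc_of_le hcZ).1 hmono.intervalIntegrable_deriv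
    have hval : ∫ z in Set.Ioc c Z, deriv (-h) z ≤ h c := by
      have h1 := hmono.intervalIntegral_deriv_mem_uIcc
      have h2 : 0 ≤ (-h) Z - (-h) c := by
        simpa using hanti Set.self_mem_Ici hcZ hcZ
      rw [Set.uIcc_of_le h2, intervalIntegral.integral_of_le hcZ] at h1
      refine h1.2.trans ?_
      simpa using hnn Z hcZ
    have hneg : deriv (-h) = fun z => -deriv h z := funext fun z => deriv.neg
    rw [hneg] at hI hval
    calc -∫ z in Set.Ioc c Z, z * deriv h z = ∫ z in Set.Ioc c Z, z * -deriv h z := by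
          rw [← integral_neg]; simp
      _ ≤ ∫ z in Set.Ioc c Z, Z * -deriv h z := by
          refine integral_mono_of_nonneg ?_ (hI.const_mul Z) ?_ <;>
          · refine (ae_restrict_iff' measurableSet_Ioc).2 (ae_of_all _ fun z hz => ?_)
            have := hd0 z hz.1
            have h0 : 0 ≤ z := hc.trans hz.1.le
            have h1 := hz.2
            simp only [Pi.zero_apply]
            first
              | exact mul_nonneg h0 (by linarith)
              | exact mul_le_mul_of_nonneg_right h1 (by linarith)
      _ = Z * ∫ z in Set.Ioc c Z, -deriv h z := integral_const_mul _ _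
      _ ≤ Z * h c := by gcongr
  · rw [Set.Ioc_eq_empty (not_lt.2 hcZ.le), hZ c le_rfl hcZ]
    simp

theorem payment_le {m : ℕ} {alloc : (Fin m → ℝ) → (Fin m → ℝ) × ℝ}
    {t : (Fin m → ℝ) → Fin m → ℝ} (ht : IsPaymentRule alloc t) {c : Fin m → ℝ} {i : Fin m} {Z : ℝ}
    (hc : 0 ≤ c i) (hZ0 : 0 ≤ Z)
    (hanti : AntitoneOn (fun z => privacyLevel alloc (Function.update c i z) i) (Set.Ici (c i)))
    (hnn : ∀ z, c i ≤ z → 0 ≤ privacyLevel alloc (Function.update c i z) i)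
    (hZ : ∀ z, c i ≤ z → Z < z → privacyLevel alloc (Function.update c i z) i = 0) :
    t c i ≤ Z * privacyLevel alloc c i := by
  have hup : privacyLevel alloc (Function.update c i (c i)) i = privacyLevel alloc c i := by
    rw [Function.update_eq_self]
  rcases ht with rfl | rfl
  · have := neg_integral_mul_deriv_le_of_antitoneOn hc hZ0 hanti hnn hZ
    rwa [hup] at this
  · have := byParts_le_of_antitoneOn hanti hZ
    rwa [hup] at this

section

/-! ### The outcome of step one at typical reports -/

variable {f : ℝ → ℝ} {μ γ c₁ r₁ r₂ h : ℝ} {m : ℕ} {c : Fin m → ℝ}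

/-- The constant `B` in the bound `B μ / h` on the optimal proxy loss for `h ^ 4` sellers and
`σ = μ ^ 2`. -/
noncomputable def lossConst (γ r₁ r₂ : ℝ) : ℝ := 2 / √r₁ + 1 + γ * (1 + r₂ / r₁)

theorem one_le_lossConst (hγ : 0 < γ) (h₁ : 0 < r₁) (h₂ : 0 ≤ r₂) : 1 ≤ lossConst γ r₁ r₂ := by
  have : 0 ≤ 2 / √r₁ := by positivity
  have : 0 ≤ γ * (1 + r₂ / r₁) := by positivity
  unfold lossConst; linarith

/-- The number of reports that are at most `s`. -/
noncomputable def reportCount (c : Fin m → ℝ) (s : ℝ) : ℕ := (Finset.univ.filter fun i => c i ≤ s).card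

/-- Reports for which the numbers of very cheap sellers, on the scale `h⁻²` of the active ones, are
of the expected order. The extra `1` in `many` is there because one seller may be removed. -/
structure TypicalReports (f : ℝ → ℝ) (γ r₁ r₂ h : ℝ) (c : Fin m → ℝ) : Prop where
  pos : ∀ i, 0 < c i
  density_ne_zero : ∀ i, f (c i) ≠ 0
  many : r₁ * h ^ 2 / 4 + 1 ≤ reportCount c (1 / h ^ 2)
  few : (reportCount c (1 / (12 * lossConst γ r₁ r₂ ^ 2 * r₂ * h ^ 2)) : ℝ) ≤
    h ^ 2 / (4 * lossConst γ r₁ r₂ ^ 2)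

/-- All the bounds that follow from enough cheap sellers: the weights are spread out, `η` is large,
and only sellers with small reports are active. -/
theorem stepOne_bounds (hf : IsCostDensity f) (h₁ : 0 < r₁)
    (hb : ∀ c ∈ Set.Icc (0 : ℝ) c₁, r₁ ≤ f c ∧ f c ≤ r₂) (hγ : 0 < γ) (hμ : 0 < μ) (hh : 0 < h)
    (hc₁ : 1 / h ^ 2 ≤ c₁) (hc : ∀ i, 0 < c i) {S : Finset (Fin m)}
    (hcard : r₁ * h ^ 2 / 4 ≤ S.card) (hS : ∀ i ∈ S, c i ≤ 1 / h ^ 2)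
    {alloc : (Fin m → ℝ) → (Fin m → ℝ) × ℝ} (halloc : IsStepOneRule f μ (μ ^ 2) γ alloc) :
    IsStepOneSolution f μ (μ ^ 2) γ c (alloc c) ∧
      √(∑ i, (alloc c).1 i ^ 2) ≤ lossConst γ r₁ r₂ / h ∧
      μ * h / lossConst γ r₁ r₂ ≤ (alloc c).2 ∧
      ∀ i, 0 < (alloc c).1 i → c i ≤ 2 * lossConst γ r₁ r₂ ^ 2 / (γ * h ^ 2) := by
  have hcard0 : (0 : ℝ) < S.card := lt_of_lt_of_le (by positivity) hcard
  have hSne : S.Nonempty := Finset.card_pos.1 (by exact_mod_cast hcard0)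
  have hmem : ∀ i ∈ S, c i ∈ Set.Icc 0 c₁ := fun i hi => ⟨(hc i).le, (hS i hi).trans hc₁⟩
  have hne : ∀ i ∈ S, f (c i) ≠ 0 := fun i hi => (h₁.trans_le (hb _ (hmem i hi)).1).ne'
  have h₂ : 0 ≤ r₂ := by
    obtain ⟨i, hi⟩ := hSne
    exact h₁.le.trans ((hb _ (hmem i hi)).1.trans (hb _ (hmem i hi)).2)
  have hB : 0 < lossConst γ r₁ r₂ := one_pos.trans_le (one_le_lossConst hγ h₁ h₂)
  have hsol : IsStepOneSolution f μ (μ ^ 2) γ c (alloc c) :=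
    halloc.isSolution c (exists_isStepOneSolution hf.nonneg hμ.le (by positivity) hγ hc
      (hSne.imp fun i hi => hne i hi))
  set p := alloc c
  have hη : 0 < p.2 := hsol.1.2.2.1
  have hloss : proxyLoss f μ (μ ^ 2) γ c p ≤ lossConst γ r₁ r₂ * μ / h := by
    refine (proxyLoss_le_of_cheap (η := μ * h) (k := r₁ * h ^ 2 / 4)
      (v := 1 / h ^ 2 * (1 + r₂ / r₁)) hμ.le hγ.le hsol hSne (by positivity) (by positivity) hcard
      hne fun i hi => ?_).trans ?_
    · refine (virtualCost_le hf h₁ hb (hmem i hi)).trans ?_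
      have := hS i hi
      gcongr
    · have e : √(r₁ * h ^ 2 / 4) = √r₁ * h / 2 := by
        rw [show r₁ * h ^ 2 / 4 = r₁ * (h / 2) ^ 2 by ring, Real.sqrt_mul h₁.le,
          Real.sqrt_sq (by positivity)]
        ring
      have : √r₁ ≠ 0 := (Real.sqrt_pos.2 h₁).ne'
      rw [e, lossConst]
      apply le_of_eq
      field_simp
  have hlow := (norm_add_inv_le_proxyLoss (μ := μ) (σ := μ ^ 2) hf.nonneg hγ.le
    (fun i => (hc i).le) hsol.1).trans hloss
  have hN : 0 ≤ √(∑ i, p.1 i ^ 2) := Real.sqrt_nonneg _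
  have hηlow : μ * h / lossConst γ r₁ r₂ ≤ p.2 := by
    have h3 : μ ^ 2 / p.2 ≤ lossConst γ r₁ r₂ * μ / h := by
      have := mul_nonneg hμ.le hN
      linarith
    rw [div_le_div_iff₀ hη hh] at h3
    rw [div_le_iff₀ hB]
    nlinarith
  refine ⟨hsol, ?_, hηlow, fun i hi => ?_⟩
  · have h3 : μ * √(∑ i, p.1 i ^ 2) ≤ lossConst γ r₁ r₂ * μ / h := by
      have : 0 ≤ μ ^ 2 / p.2 := by positivity
      linarith
    rw [le_div_iff₀ hh] at h3 ⊢
    nlinarith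
  · have h3 := virtualCost_mul_le_of_pos hf.nonneg hμ.le (by positivity) hγ.le
      (fun i => (hc i).le) hsol hi
    have h4 : γ * c i * (μ * h / lossConst γ r₁ r₂) ≤ 2 * (lossConst γ r₁ r₂ * μ / h) := by
      calc γ * c i * (μ * h / lossConst γ r₁ r₂) ≤ γ * virtualCost f (c i) * p.2 := by
            have := le_virtualCost hf.nonneg (c i)
            have := (hc i).le
            have : 0 ≤ γ * virtualCost f (c i) := mul_nonneg hγ.le (by linarith)
            gcongr
        _ ≤ _ := h3.trans (by gcongr)
    rw [le_div_iff₀ (by positivity)]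
    have e1 : γ * c i * (μ * h / lossConst γ r₁ r₂) =
        c i * (γ * h ^ 2) * (μ / (h * lossConst γ r₁ r₂)) := by field_simp
    have e2 : 2 * (lossConst γ r₁ r₂ * μ / h) =
        2 * lossConst γ r₁ r₂ ^ 2 * (μ / (h * lossConst γ r₁ r₂)) := by field_simp
    rw [e1, e2] at h4
    exact le_of_mul_le_mul_right h4 (by positivity)

/-- Few very cheap sellers keep `η` of order `μ h`: the weights are spread out, so that at least
half of the total weight lies on sellers that are not very cheap. -/
theorem eta_le_of_typical (hf : IsCostDensity f) (h₁ : 0 < r₁) (h₂ : 0 < r₂) (hγ : 0 < γ)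
    (hμ : 0 < μ) (hh : 0 < h) (hc : TypicalReports f γ r₁ r₂ h c) {p : (Fin m → ℝ) × ℝ}
    (hp : IsStepOneSolution f μ (μ ^ 2) γ c p)
    (hnorm : √(∑ i, p.1 i ^ 2) ≤ lossConst γ r₁ r₂ / h) :
    p.2 ≤ μ * h * (lossConst γ r₁ r₂ * √(48 * r₂ / γ)) := by
  have hB : 0 < lossConst γ r₁ r₂ := one_pos.trans_le (one_le_lossConst hγ h₁ h₂.le)
  set B := lossConst γ r₁ r₂ with hBdef
  set s := 1 / (12 * B ^ 2 * r₂ * h ^ 2) with hs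
  have hs0 : 0 < s := by positivity
  set T := Finset.univ.filter fun i => c i ≤ s with hT
  have hfew : (T.card : ℝ) ≤ h ^ 2 / (4 * B ^ 2) := hc.few
  have hTsum : ∑ i ∈ T, p.1 i ≤ 1 / 2 := by
    have h1 : (∑ i ∈ T, p.1 i) ^ 2 ≤ (1 / 2) ^ 2 := by
      calc (∑ i ∈ T, p.1 i) ^ 2 ≤ T.card * ∑ i ∈ T, p.1 i ^ 2 := sq_sum_le_card_mul_sum_sq
        _ ≤ T.card * ∑ i, p.1 i ^ 2 := by
            gcongr
            exact Finset.subset_univ _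
        _ = T.card * √(∑ i, p.1 i ^ 2) ^ 2 := by
            rw [Real.sq_sqrt (Finset.sum_nonneg fun i _ => sq_nonneg _)]
        _ ≤ h ^ 2 / (4 * B ^ 2) * (B / h) ^ 2 := by gcongr
        _ = (1 / 2) ^ 2 := by field_simp; norm_num
    exact le_of_sq_le_sq h1 (by norm_num)
  have hsum : s / 2 ≤ ∑ i, p.1 i * virtualCost f (c i) := by
    have h1 : ∑ i, (p.1 i * s - if i ∈ T then p.1 i * s else 0) ≤
        ∑ i, p.1 i * virtualCost f (c i) := by
      refine Finset.sum_le_sum fun i _ => ?_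
      have hpi := hp.1.1 i
      have hle := le_virtualCost hf.nonneg (c i)
      have := (hc.pos i).le
      split_ifs with hi
      · rw [sub_self]; exact mul_nonneg hpi (by linarith)
      · have : s ≤ c i := by
          by_contra h'
          exact hi (by simp [hT, (not_le.1 h').le])
        rw [sub_zero]; gcongr; linarith
    refine le_trans ?_ h1
    rw [Finset.sum_sub_distrib, Finset.sum_ite_mem, Finset.univ_inter, ← Finset.sum_mul,
      ← Finset.sum_mul, hp.1.2.1]
    nlinarith
  have h1 := cost_mul_sq_le hp
  have h2 : γ * (s / 2) * p.2 ^ 2 ≤ 2 * μ ^ 2 := le_trans (by gcongr) h1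
  refine le_of_sq_le_sq ?_ (by positivity)
  have e : (μ * h * (B * √(48 * r₂ / γ))) ^ 2 = 2 * μ ^ 2 / (γ * (s / 2)) := by
    rw [mul_pow, mul_pow B, Real.sq_sqrt (by positivity), hs]
    field_simp
    norm_num
  rw [e, le_div_iff₀ (by positivity)]
  linarith

/-- The payments in terms of the optimal `η`: every seller is paid at most the largest active
report per unit of privacy. -/
theorem sum_payment_le (hf : IsCostDensity f) (hreg : RegularVirtualCost f) (h₁ : 0 < r₁)
    (hb : ∀ c ∈ Set.Icc (0 : ℝ) c₁, r₁ ≤ f c ∧ f c ≤ r₂) (hγ : 0 < γ) (hμ : 0 < μ) (hh : 0 < h)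
    (hc₁ : 1 / h ^ 2 ≤ c₁) (hZ : 2 * lossConst γ r₁ r₂ ^ 2 / (γ * h ^ 2) ≤ c₁)
    (hc : TypicalReports f γ r₁ r₂ h c)
    {alloc : (Fin m → ℝ) → (Fin m → ℝ) × ℝ} (halloc : IsStepOneRule f μ (μ ^ 2) γ alloc)
    {t : (Fin m → ℝ) → Fin m → ℝ} (ht : IsPaymentRule alloc t)
    (hsol : IsStepOneSolution f μ (μ ^ 2) γ c (alloc c)) :
    ∑ i, t c i ≤ 2 * lossConst γ r₁ r₂ ^ 2 / (γ * h ^ 2) * (alloc c).2 := by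
  set Z := 2 * lossConst γ r₁ r₂ ^ 2 / (γ * h ^ 2) with hZdef
  have hZ0 : 0 ≤ Z := by positivity
  have hbd : ∀ i, ∀ z, 0 < z → IsStepOneSolution f μ (μ ^ 2) γ (Function.update c i z)
      (alloc (Function.update c i z)) ∧
      (0 < (alloc (Function.update c i z)).1 i → z ≤ Z) := by
    intro i z hz
    have hpos : ∀ j, 0 < Function.update c i z j := by
      intro j
      rcases eq_or_ne j i with rfl | hj
      · simpa using hz
      · simpa [hj] using hc.pos j
    have hcard : r₁ * h ^ 2 / 4 ≤
        (((Finset.univ.filter fun j => c j ≤ 1 / h ^ 2).erase i).card : ℝ) := by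
      have h3 := hc.many
      have h4 : ((Finset.univ.filter fun j => c j ≤ 1 / h ^ 2).card : ℝ) ≤
          ((Finset.univ.filter fun j => c j ≤ 1 / h ^ 2).erase i).card + 1 := by
        exact_mod_cast Nat.sub_le_iff_le_add.1 Finset.pred_card_le_card_erase
      unfold reportCount at h3
      linarith
    have hcheap : ∀ j ∈ (Finset.univ.filter fun j => c j ≤ 1 / h ^ 2).erase i,
        Function.update c i z j ≤ 1 / h ^ 2 := by
      intro j hj
      have hj' := Finset.mem_erase.1 hj
      rw [Function.update_of_ne hj'.1]
      exact (Finset.mem_filter.1 hj'.2).2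
    obtain ⟨h1, -, -, h2⟩ := stepOne_bounds hf h₁ hb hγ hμ hh hc₁ hpos hcard hcheap halloc
    exact ⟨h1, fun hi => by simpa using h2 i hi⟩
  have key : ∀ i, t c i ≤ Z * privacyLevel alloc c i := by
    intro i
    have hnn : ∀ z, c i ≤ z → 0 ≤ privacyLevel alloc (Function.update c i z) i := fun z hz => by
      obtain ⟨h1, -⟩ := hbd i z ((hc.pos i).trans_le hz)
      exact mul_nonneg (h1.1.1 i) h1.1.2.2.1.le
    have hzero : ∀ z, c i ≤ z → Z < z → privacyLevel alloc (Function.update c i z) i = 0 := by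
      intro z hz hz'
      obtain ⟨h1, h2⟩ := hbd i z ((hc.pos i).trans_le hz)
      have : (alloc (Function.update c i z)).1 i = 0 :=
        le_antisymm (not_lt.1 fun h' => not_le.2 hz' (h2 h')) (h1.1.1 i)
      rw [privacyLevel, this, zero_mul]
    refine payment_le ht (hc.pos i).le hZ0 (fun x hx y hy hxy => ?_) hnn hzero
    rcases eq_or_lt_of_le hxy with rfl | hlt
    · exact le_rfl
    rcases lt_or_ge Z y with hy' | hy'
    · simp only
      rw [hzero y hy hy']
      exact hnn x hx
    · have hx0 : 0 < x := (hc.pos i).trans_le hx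
      have hfx := h₁.trans_le (hb x ⟨hx0.le, hxy.trans (hy'.trans hZ)⟩).1
      have hfy := h₁.trans_le (hb y ⟨(hx0.trans hlt).le, hy'.trans hZ⟩).1
      refine privacy_le_of_virtualCost_lt hγ (fun j hj => ?_) ?_ ?_ ?_ (hbd i x hx0).1
        (hbd i y (hx0.trans hlt)).1
      · rw [Function.update_of_ne hj, Function.update_of_ne hj]
      · simpa using hfx.ne'
      · simpa using hfy.ne'
      · simpa using hreg hfx hfy hlt
  calc ∑ i, t c i ≤ ∑ i, Z * privacyLevel alloc c i := Finset.sum_le_sum fun i _ => key i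
    _ = Z * (alloc c).2 := by
      simp only [privacyLevel]
      rw [← Finset.mul_sum, ← Finset.sum_mul, hsol.1.2.1, one_mul]

end

section

/-! ### The logistic loss -/

/-- The negative derivative of the logistic loss. -/
noncomputable def logisticSlope (z : ℝ) : ℝ := 1 / (1 + Real.exp z) / Real.log 2

theorem log_two_pos : 0 < Real.log 2 := Real.log_pos one_lt_two

theorem logisticSlope_nonneg (z : ℝ) : 0 ≤ logisticSlope z := by
  have := log_two_pos
  unfold logisticSlope; positivity

theorem logisticSlope_le (z : ℝ) : logisticSlope z ≤ 1 / Real.log 2 := by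
  have := log_two_pos
  unfold logisticSlope
  gcongr
  rw [div_le_one (by positivity)]
  linarith [Real.exp_pos z]

theorem logisticSlope_anti {y z : ℝ} (h : y ≤ z) : logisticSlope z ≤ logisticSlope y := by
  have := log_two_pos
  unfold logisticSlope
  gcongr

theorem continuous_logisticSlope : Continuous logisticSlope := by
  unfold logisticSlope
  exact (continuous_const.div (by fun_prop) fun z => by positivity).div_const _

theorem continuous_logisticLoss : Continuous logisticLoss := by
  unfold logisticLoss Real.logb
  exact (Continuous.log (by fun_prop) fun z => by positivity).div_const _

theorem logisticLoss_nonneg (z : ℝ) : 0 ≤ logisticLoss z :=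
  Real.logb_nonneg one_lt_two (by linarith [Real.exp_pos (-z)])

theorem logisticLoss_anti {y z : ℝ} (h : y ≤ z) : logisticLoss z ≤ logisticLoss y :=
  Real.logb_le_logb_of_le one_lt_two (by positivity) (by gcongr)

theorem one_le_logisticLoss {z : ℝ} (h : z ≤ 0) : 1 ≤ logisticLoss z := by
  refine le_trans (le_of_eq ?_) (logisticLoss_anti h)
  norm_num [logisticLoss]

/-- The logistic loss lies above its tangents, by convexity of the exponential. -/
theorem logisticLoss_tangent (z u : ℝ) :
    logisticLoss z - logisticSlope z * (u - z) ≤ logisticLoss u := by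
  have hl := log_two_pos
  set l := 1 / (1 + Real.exp z) with hlam
  have hl0 : 0 ≤ l := by positivity
  have hl1 : l ≤ 1 := by
    rw [hlam, div_le_one (by positivity)]; linarith [Real.exp_pos z]
  have hconv := convexOn_exp.2 (Set.mem_univ 0) (Set.mem_univ (-(u - z))) (sub_nonneg.2 hl1) hl0
    (by ring)
  simp only [smul_eq_mul, mul_zero, zero_add, Real.exp_zero, mul_one] at hconv
  have hprod : (1 + Real.exp (-z)) * (1 - l + l * Real.exp (-(u - z))) = 1 + Real.exp (-u) := by
    have e1 : Real.exp (-(u - z)) = Real.exp (-u) * Real.exp z := by rw [← Real.exp_add]; ring_nf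
    have e2 : Real.exp (-z) = 1 / Real.exp z := by rw [Real.exp_neg, one_div]
    have := Real.exp_pos z
    rw [e1, e2, hlam]
    field_simp
    ring
  have h1 : Real.log (1 + Real.exp (-z)) + l * -(u - z) ≤ Real.log (1 + Real.exp (-u)) := by
    rw [← Real.log_exp (l * -(u - z)), ← Real.log_mul (by positivity) (by positivity), ← hprod]
    refine Real.log_le_log (by positivity) ?_
    gcongr
  have h2 := div_le_div_of_nonneg_right h1 hl.le
  unfold logisticLoss logisticSlope Real.logb
  calc _ = (Real.log (1 + Real.exp (-z)) + l * -(u - z)) / Real.log 2 := by rw [hlam]; ring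
    _ ≤ _ := h2

theorem logisticLoss_le_add (z u : ℝ) : logisticLoss z ≤ logisticLoss u + |u - z| / Real.log 2 := by
  have h1 := logisticLoss_tangent z u
  have h2 : logisticSlope z * (u - z) ≤ |u - z| / Real.log 2 := by
    calc logisticSlope z * (u - z) ≤ logisticSlope z * |u - z| :=
          mul_le_mul_of_nonneg_left (le_abs_self _) (logisticSlope_nonneg z)
      _ ≤ 1 / Real.log 2 * |u - z| :=
          mul_le_mul_of_nonneg_right (logisticSlope_le z) (abs_nonneg _)
      _ = _ := by ring
  linarith

/-! ### The regression step -/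

variable {n m : ℕ}

/-- A data point with a feature in the unit ball and a label `±1`. -/
def IsValidPoint (z : DataPoint n) : Prop := ‖z.1‖ ≤ 1 ∧ (z.2 = 1 ∨ z.2 = -1)

theorem abs_margin_le {z : DataPoint n} (hz : IsValidPoint z) (w : Feature n) :
    |z.2 * ⟪w, z.1⟫| ≤ ‖w‖ := by
  have h2 : |z.2| = 1 := by rcases hz.2 with h | h <;> simp [h]
  rw [abs_mul, h2, one_mul]
  calc |⟪w, z.1⟫| ≤ ‖w‖ * ‖z.1‖ := abs_real_inner_le_norm _ _
    _ ≤ ‖w‖ * 1 := by gcongr; exact hz.1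
    _ = ‖w‖ := mul_one _

theorem logisticLoss_margin_le_add {z : DataPoint n} (hz : IsValidPoint z) (w u : Feature n) :
    logisticLoss (z.2 * ⟪w, z.1⟫) ≤
      logisticLoss (z.2 * ⟪u, z.1⟫) + ‖u - w‖ / Real.log 2 := by
  have hl := log_two_pos
  refine (logisticLoss_le_add _ (z.2 * ⟪u, z.1⟫)).trans ?_
  have := abs_margin_le hz (u - w)
  rw [inner_sub_left, mul_sub] at this
  gcongr

/-- The part of the training objective without the regularization term. -/
noncomputable def perturbedLoss (D : Fin m → DataPoint n) (p : (Fin m → ℝ) × ℝ) (b w : Feature n) :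
    ℝ :=
  ∑ i, p.1 i * logisticLoss ((D i).2 * ⟪w, (D i).1⟫) + 2 * ⟪b, w⟫ / p.2

/-- The gradient of `perturbedLoss`. -/
noncomputable def perturbedGrad (D : Fin m → DataPoint n) (p : (Fin m → ℝ) × ℝ) (b w : Feature n) :
    Feature n :=
  (2 / p.2) • b -
    ∑ i, (p.1 i * logisticSlope ((D i).2 * ⟪w, (D i).1⟫) * (D i).2) • (D i).1

variable {D : Fin m → DataPoint n} {p : (Fin m → ℝ) × ℝ} {b : Feature n} {β ρ : ℝ}

theorem continuous_perturbedLoss : Continuous (perturbedLoss D p b) := by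
  have := continuous_logisticLoss
  unfold perturbedLoss
  fun_prop

theorem continuous_perturbedGrad : Continuous (perturbedGrad D p b) := by
  have := continuous_logisticSlope
  unfold perturbedGrad
  fun_prop

theorem inner_perturbedGrad (w v : Feature n) : ⟪perturbedGrad D p b w, v⟫ =
    2 * ⟪b, v⟫ / p.2 -
      ∑ i, p.1 i * (logisticSlope ((D i).2 * ⟪w, (D i).1⟫) * ((D i).2 * ⟪v, (D i).1⟫)) := by
  rw [perturbedGrad, inner_sub_left, sum_inner, real_inner_smul_left]
  congr 1
  · ring
  · refine Finset.sum_congr rfl fun i _ => ?_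
    rw [real_inner_smul_left, real_inner_comm v (D i).1]
    ring

theorem perturbedLoss_tangent (hp : ∀ i, 0 ≤ p.1 i) (w u : Feature n) :
    perturbedLoss D p b w + ⟪perturbedGrad D p b w, u - w⟫ ≤ perturbedLoss D p b u := by
  rw [inner_perturbedGrad]
  have h : ∑ i, p.1 i * logisticLoss ((D i).2 * ⟪w, (D i).1⟫) -
      ∑ i, p.1 i * (logisticSlope ((D i).2 * ⟪w, (D i).1⟫) * ((D i).2 * ⟪u - w, (D i).1⟫)) ≤
      ∑ i, p.1 i * logisticLoss ((D i).2 * ⟪u, (D i).1⟫) := by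
    rw [← Finset.sum_sub_distrib]
    refine Finset.sum_le_sum fun i _ => ?_
    rw [← mul_sub]
    refine mul_le_mul_of_nonneg_left ?_ (hp i)
    rw [inner_sub_left, mul_sub]
    exact logisticLoss_tangent _ _
  have e : 2 * ⟪b, u - w⟫ / p.2 = 2 * ⟪b, u⟫ / p.2 - 2 * ⟪b, w⟫ / p.2 := by
    rw [inner_sub_right]; ring
  unfold perturbedLoss
  linarith

/-- First-order optimality over a ball, obtained from the tangent inequality at nearby points. -/
theorem inner_perturbedGrad_nonneg (hp : ∀ i, 0 ≤ p.1 i) {w : Feature n}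
    (hw : w ∈ Metric.closedBall 0 β)
    (hmin : IsMinOn (perturbedLoss D p b) (Metric.closedBall 0 β) w) {u : Feature n}
    (hu : u ∈ Metric.closedBall 0 β) : 0 ≤ ⟪perturbedGrad D p b w, u - w⟫ := by
  have hcont : Continuous fun s : ℝ => ⟪perturbedGrad D p b (w + s • (u - w)), u - w⟫ := by
    have := continuous_perturbedGrad (D := D) (p := p) (b := b)
    fun_prop
  have hlim : Tendsto (fun s : ℝ => ⟪perturbedGrad D p b (w + s • (u - w)), u - w⟫) (𝓝[>] 0)
      (𝓝 ⟪perturbedGrad D p b w, u - w⟫) := by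
    have := hcont.tendsto 0
    simp only [zero_smul, add_zero] at this
    exact this.mono_left nhdsWithin_le_nhds
  refine ge_of_tendsto hlim ?_
  filter_upwards [Ioo_mem_nhdsGT one_pos] with s hs
  have hmem : w + s • (u - w) ∈ Metric.closedBall 0 β :=
    (convex_closedBall 0 β).add_smul_sub_mem hw hu ⟨hs.1.le, hs.2.le⟩
  have h1 := hmin hmem
  have h2 := perturbedLoss_tangent (D := D) (b := b) hp (w + s • (u - w)) w
  simp only [Set.mem_ofPred_eq] at h1
  have e : w - (w + s • (u - w)) = -(s • (u - w)) := by abel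
  rw [e, inner_neg_right, real_inner_smul_right] at h2
  have h3 : 0 ≤ s * ⟪perturbedGrad D p b (w + s • (u - w)), u - w⟫ := by linarith
  exact nonneg_of_mul_nonneg_right h3 hs.1

/-- If the noise is small, the loss decreases in the direction of a separating vector throughout
the ball of radius `β`. Hence its minimizer over the ball lies on the sphere, and the multiplier of
the constraint is the regularization parameter. -/
theorem exists_isTunedOutput (hβ : 0 < β) (hp : ∀ i, 0 ≤ p.1 i) (hsum : ∑ i, p.1 i = 1)
    (hη : 0 < p.2) (hD : ∀ i, IsValidPoint (D i)) {v : Feature n} (hv : ‖v‖ = 1)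
    (hsep : ∀ i, ρ ≤ ⟪v, (D i).1⟫ * (D i).2) (hρ : 0 < ρ)
    (hb : 2 * ‖b‖ / p.2 < ρ * logisticSlope β) : ∃ w, IsTunedOutput D p b β w := by
  obtain ⟨w, hw, hmin⟩ := (isCompact_closedBall (0 : Feature n) β).exists_isMinOn
    ⟨0, Metric.mem_closedBall_self hβ.le⟩
    (continuous_perturbedLoss (D := D) (p := p) (b := b)).continuousOn
  have hwn : ‖w‖ ≤ β := by simpa using hw
  have hopt := fun u hu => inner_perturbedGrad_nonneg hp hw hmin (u := u) hu
  set g := perturbedGrad D p b w with hg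
  have hneg : ⟪g, v⟫ < 0 := by
    rw [hg, inner_perturbedGrad]
    have h1 : 2 * ⟪b, v⟫ / p.2 ≤ 2 * ‖b‖ / p.2 := by
      have := real_inner_le_norm b v
      rw [hv, mul_one] at this
      gcongr
    have h2 : ρ * logisticSlope β ≤
        ∑ i, p.1 i * (logisticSlope ((D i).2 * ⟪w, (D i).1⟫) * ((D i).2 * ⟪v, (D i).1⟫)) := by
      calc ρ * logisticSlope β = ∑ i, p.1 i * (logisticSlope β * ρ) := by
            rw [← Finset.sum_mul, hsum]; ring
        _ ≤ _ := by
          refine Finset.sum_le_sum fun i _ => mul_le_mul_of_nonneg_left ?_ (hp i)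
          have h3 := (abs_le.1 (abs_margin_le (hD i) w)).2.trans hwn
          have h4 := hsep i
          rw [mul_comm] at h4
          exact mul_le_mul (logisticSlope_anti h3) h4 hρ.le (logisticSlope_nonneg _)
    linarith
  have hg0 : 0 < ‖g‖ := norm_pos_iff.2 fun h => by simp [h] at hneg
  set u : Feature n := -(β / ‖g‖) • g with hu
  have hun : ‖u‖ = β := by
    rw [hu, norm_smul, norm_neg, Real.norm_of_nonneg (by positivity), div_mul_cancel₀ _ hg0.ne']
  have hgu : ⟪g, u⟫ = -(β * ‖g‖) := by
    rw [hu, real_inner_smul_right, real_inner_self_eq_norm_sq]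
    field_simp
  have h1 := hopt u (by simp [hun])
  rw [inner_sub_right, hgu] at h1
  have hwu : w = u := by
    rw [← sub_eq_zero, ← norm_eq_zero, ← sq_eq_zero_iff]
    refine le_antisymm ?_ (sq_nonneg _)
    have h2 : β ^ 2 ≤ ⟪w, u⟫ := by
      rw [hu, real_inner_smul_right, real_inner_comm]
      have : β / ‖g‖ * (β * ‖g‖) ≤ β / ‖g‖ * -⟪g, w⟫ := by
        gcongr; linarith
      have e : β / ‖g‖ * (β * ‖g‖) = β ^ 2 := by field_simp
      linarith
    rw [norm_sub_sq_real, hun]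
    nlinarith [norm_nonneg w]
  have hgw : g = -(‖g‖ / β) • w := by
    rw [hwu, hu, smul_smul]
    have : -(‖g‖ / β) * -(β / ‖g‖) = 1 := by field_simp
    rw [this, one_smul]
  refine ⟨w, ⟨‖g‖ / β, by positivity, fun x => ?_⟩, hwu ▸ hun⟩
  have h2 := perturbedLoss_tangent (D := D) (b := b) hp w x
  rw [← hg, hgw, real_inner_smul_left, inner_sub_right, real_inner_self_eq_norm_sq] at h2
  have h3 : 0 ≤ ‖g‖ / β / 2 * ‖x - w‖ ^ 2 := by positivity
  rw [norm_sub_sq_real, real_inner_comm] at h3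
  change perturbedLoss D p b w + _ ≤ perturbedLoss D p b x + _
  linarith

/-- The training loss of the output, compared with that of the separating vector. -/
theorem trainingLoss_le (hβ : 0 < β) (hp : ∀ i, 0 ≤ p.1 i) (hsum : ∑ i, p.1 i = 1)
    (hη : 0 < p.2) {v : Feature n} (hv : ‖v‖ = 1)
    (hsep : ∀ i, ρ ≤ ⟪v, (D i).1⟫ * (D i).2) {w : Feature n} (hw : IsTunedOutput D p b β w) :
    ∑ i, p.1 i * logisticLoss ((D i).2 * ⟪w, (D i).1⟫) ≤
      logisticLoss (ρ * β) + 4 * β * ‖b‖ / p.2 := by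
  obtain ⟨⟨Λ, -, hmin⟩, hwn⟩ := hw
  have h1 := hmin (β • v)
  have hbn : ‖β • v‖ = β := by rw [norm_smul, hv, mul_one, Real.norm_of_nonneg hβ.le]
  unfold trainingObjective at h1
  rw [hwn, hbn] at h1
  have h2 : ∑ i, p.1 i * logisticLoss ((D i).2 * ⟪β • v, (D i).1⟫) ≤ logisticLoss (ρ * β) := by
    calc _ ≤ ∑ i, p.1 i * logisticLoss (ρ * β) := by
          refine Finset.sum_le_sum fun i _ =>
            mul_le_mul_of_nonneg_left (logisticLoss_anti ?_) (hp i)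
          rw [real_inner_smul_left]
          have := mul_le_mul_of_nonneg_right (hsep i) hβ.le
          linarith
      _ = logisticLoss (ρ * β) := by rw [← Finset.sum_mul, hsum, one_mul]
  have h3 : 2 * ⟪b, β • v⟫ / p.2 - 2 * ⟪b, w⟫ / p.2 ≤ 4 * β * ‖b‖ / p.2 := by
    rw [← sub_div]
    gcongr
    have h4 := real_inner_le_norm b (β • v)
    have h5 := (abs_le.1 (abs_real_inner_le_norm b w)).1
    rw [hbn] at h4
    rw [hwn] at h5
    linarith
  linarith

/-! ### The risk -/

/-- The expected logistic loss. -/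
noncomputable def risk (𝒟 : Measure (DataPoint n)) (w : Feature n) : ℝ :=
  ∫ z, logisticLoss (z.2 * ⟪w, z.1⟫) ∂𝒟

theorem measurable_logisticLoss_margin (w : Feature n) :
    Measurable fun z : DataPoint n => logisticLoss (z.2 * ⟪w, z.1⟫) := by
  have := continuous_logisticLoss
  exact Continuous.measurable (by fun_prop)

theorem logisticLoss_margin_mem {z : DataPoint n} (hz : IsValidPoint z) {w : Feature n}
    (hw : ‖w‖ ≤ β) : logisticLoss (z.2 * ⟪w, z.1⟫) ∈ Set.Icc 0 (logisticLoss (-β)) :=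
  ⟨logisticLoss_nonneg _, logisticLoss_anti
    ((neg_le_neg hw).trans (abs_le.1 (abs_margin_le hz w)).1)⟩

variable {𝒟 : Measure (DataPoint n)} [IsProbabilityMeasure 𝒟]

theorem integrable_logisticLoss_margin (h𝒟 : IsDataLaw 𝒟) (w : Feature n) :
    Integrable (fun z : DataPoint n => logisticLoss (z.2 * ⟪w, z.1⟫)) 𝒟 :=
  Integrable.of_mem_Icc 0 (logisticLoss (-‖w‖)) (measurable_logisticLoss_margin w).aemeasurable
    (h𝒟.mono fun _ hz => logisticLoss_margin_mem hz le_rfl)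

/-- The logistic loss to base two dominates the misclassification loss. -/
theorem misclassification_le_risk (h𝒟 : IsDataLaw 𝒟) (w : Feature n) :
    𝒟.real {z | Real.sign ⟪w, z.1⟫ ≠ z.2} ≤ risk 𝒟 w := by
  set S : Set (DataPoint n) := {z | 1 ≤ logisticLoss (z.2 * ⟪w, z.1⟫)} with hS
  have hSm : MeasurableSet S := measurableSet_le measurable_const (measurable_logisticLoss_margin w)
  have h1 : 𝒟.real {z | Real.sign ⟪w, z.1⟫ ≠ z.2} ≤ 𝒟.real S := by
    refine ENNReal.toReal_mono (measure_ne_top _ _) (measure_mono_ae ?_)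
    filter_upwards [h𝒟] with z hz hne
    refine one_le_logisticLoss ?_
    by_contra! hpos
    apply hne
    rcases hz.2 with h | h
    · rw [h, one_mul] at hpos
      rw [h, Real.sign_of_pos hpos]
    · rw [h] at hpos
      rw [h, Real.sign_of_neg (by linarith)]
  refine h1.trans ?_
  rw [← integral_indicator_one hSm]
  refine integral_mono ((integrable_const (1 : ℝ)).indicator hSm)
    (integrable_logisticLoss_margin h𝒟 w) fun z => ?_
  by_cases hz : z ∈ S
  · rw [Set.indicator_of_mem hz]
    exact hz
  · simpa [hz] using logisticLoss_nonneg _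

theorem risk_le_add (h𝒟 : IsDataLaw 𝒟) (w u : Feature n) :
    risk 𝒟 w ≤ risk 𝒟 u + ‖u - w‖ / Real.log 2 := by
  have h : ∫ z, (logisticLoss (z.2 * ⟪u, z.1⟫) + ‖u - w‖ / Real.log 2) ∂𝒟 =
      risk 𝒟 u + ‖u - w‖ / Real.log 2 := by
    rw [integral_add (integrable_logisticLoss_margin h𝒟 u) (integrable_const _)]
    simp [risk]
  rw [← h]
  exact integral_mono_ae (integrable_logisticLoss_margin h𝒟 w)
    ((integrable_logisticLoss_margin h𝒟 u).add (integrable_const _))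
    (h𝒟.mono fun z hz => logisticLoss_margin_le_add hz w u)

/-- Uniform convergence on the ball from convergence on a finite net. -/
theorem risk_le_of_net (h𝒟 : IsDataLaw 𝒟) (hp : ∀ i, 0 ≤ p.1 i) (hsum : ∑ i, p.1 i = 1)
    (hD : ∀ i, IsValidPoint (D i)) {w u : Feature n} {τ κ : ℝ}
    (hu : risk 𝒟 u ≤ ∑ i, p.1 i * logisticLoss ((D i).2 * ⟪u, (D i).1⟫) + τ)
    (hd : ‖u - w‖ / Real.log 2 ≤ κ) :
    risk 𝒟 w ≤ ∑ i, p.1 i * logisticLoss ((D i).2 * ⟪w, (D i).1⟫) + τ + 2 * κ := by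
  have h1 := risk_le_add h𝒟 w u
  have h2 : ∑ i, p.1 i * logisticLoss ((D i).2 * ⟪u, (D i).1⟫) ≤
      ∑ i, p.1 i * logisticLoss ((D i).2 * ⟪w, (D i).1⟫) + κ := by
    calc _ ≤ ∑ i, p.1 i * (logisticLoss ((D i).2 * ⟪w, (D i).1⟫) + κ) := by
          refine Finset.sum_le_sum fun i _ => mul_le_mul_of_nonneg_left ?_ (hp i)
          have := logisticLoss_margin_le_add (hD i) u w
          rw [norm_sub_rev] at this
          linarith
      _ = _ := by simp only [mul_add, Finset.sum_add_distrib]; rw [← Finset.sum_mul, hsum, one_mul]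
  linarith

end

section

/-! ### Tail bounds -/

theorem isProbabilityMeasure_costLaw {f : ℝ → ℝ} (hf : IsCostDensity f) :
    IsProbabilityMeasure (costLaw f) where
  measure_univ := by
    rw [costLaw, withDensity_apply _ MeasurableSet.univ, setLIntegral_univ, hf.lintegral_eq_one]

theorem ae_costLaw {f : ℝ → ℝ} (hf : IsCostDensity f) : ∀ᵐ c ∂costLaw f, 0 < c ∧ f c ≠ 0 := by
  rw [costLaw, ae_withDensity_iff hf.measurable.ennreal_ofReal]
  have h0 : ∀ᵐ c : ℝ, c ≠ 0 := by simp [ae_iff, measure_singleton]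
  filter_upwards [h0] with c hc hfc
  have hfc' : f c ≠ 0 := fun h => hfc (by simp [h])
  exact ⟨lt_of_le_of_ne (not_lt.1 fun h => hfc' (hf.zero_of_neg c h)) hc.symm, hfc'⟩

theorem isProbabilityMeasure_uniformSphere {n : ℕ} (hn : n ≠ 0) :
    IsProbabilityMeasure (uniformSphere n) := by
  have : Nonempty (Fin n) := ⟨⟨0, Nat.pos_of_ne_zero hn⟩⟩
  have : Nontrivial (Feature n) := inferInstance
  have h0 : (volume : Measure (Feature n)).toSphere Set.univ ≠ 0 := by
    rw [Ne, Measure.measure_univ_eq_zero]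
    exact Measure.toSphere_ne_zero _
  constructor
  rw [uniformSphere, Measure.smul_apply, smul_eq_mul, ENNReal.inv_mul_cancel h0 (measure_ne_top _ _)]

theorem measurable_polar (n : ℕ) : Measurable
    fun p : ℝ × Metric.sphere (0 : Feature n) 1 => p.1 • (p.2 : Feature n) :=
  measurable_fst.smul (measurable_subtype_coe.comp measurable_snd)

theorem isProbabilityMeasure_noiseLaw {n : ℕ} (hn : n ≠ 0) :
    IsProbabilityMeasure (noiseLaw n) := by
  have := isProbabilityMeasure_uniformSphere hn
  have := isProbabilityMeasure_gammaMeasure (a := n) (r := 1)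
    (by exact_mod_cast Nat.pos_of_ne_zero hn) one_pos
  exact Measure.isProbabilityMeasure_map (measurable_polar n).aemeasurable

/-- On `x > t`, the density of `Γ(n, 1)` is at most `2 ^ n * exp (-t / 2)` times that of
`Γ(n, 1 / 2)`. -/
theorem gammaMeasure_tail_le {n : ℕ} (hn : n ≠ 0) {t : ℝ} :
    gammaMeasure n 1 {r | t < |r|} ≤ ENNReal.ofReal (2 ^ n * Real.exp (-(t / 2))) := by
  have hn0 : (0 : ℝ) < n := by exact_mod_cast Nat.pos_of_ne_zero hn
  have hmeas : MeasurableSet {r : ℝ | t < |r|} := measurableSet_lt measurable_const (by fun_prop)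
  rw [gammaMeasure, withDensity_apply _ hmeas]
  calc ∫⁻ x in {r : ℝ | t < |r|}, gammaPDF n 1 x
      ≤ ∫⁻ x in {r : ℝ | t < |r|},
          ENNReal.ofReal (2 ^ n * Real.exp (-(t / 2))) * gammaPDF n (1 / 2) x := by
        refine setLIntegral_mono' hmeas fun x hx => ?_
        rcases lt_or_ge x 0 with h | h
        · simp [gammaPDF_of_neg h]
        · replace hx : t < |x| := hx
          rw [abs_of_nonneg h] at hx
          rw [gammaPDF_of_nonneg h, gammaPDF_of_nonneg h, ← ENNReal.ofReal_mul (by positivity)]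
          refine ENNReal.ofReal_le_ofReal ?_
          have e1 : Real.exp (-(1 * x)) = Real.exp (-(x / 2)) * Real.exp (-(1 / 2 * x)) := by
            rw [← Real.exp_add]; ring_nf
          have e2 : (2 : ℝ) ^ n * (1 / 2 : ℝ) ^ (n : ℝ) = 1 := by
            rw [Real.rpow_natCast, ← mul_pow]; norm_num
          have hG : 0 < Real.Gamma n := Real.Gamma_pos_of_pos hn0
          rw [e1, Real.one_rpow]
          calc 1 / Real.Gamma n * x ^ ((n : ℝ) - 1) *
                (Real.exp (-(x / 2)) * Real.exp (-(1 / 2 * x)))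
              ≤ 1 / Real.Gamma n * x ^ ((n : ℝ) - 1) *
                (Real.exp (-(t / 2)) * Real.exp (-(1 / 2 * x))) := by gcongr
            _ = (2 ^ n * (1 / 2 : ℝ) ^ (n : ℝ)) / Real.Gamma n * x ^ ((n : ℝ) - 1) *
                (Real.exp (-(t / 2)) * Real.exp (-(1 / 2 * x))) := by rw [e2]
            _ = _ := by ring
    _ ≤ ∫⁻ x, ENNReal.ofReal (2 ^ n * Real.exp (-(t / 2))) * gammaPDF n (1 / 2) x :=
        setLIntegral_le_lintegral _ _
    _ = ENNReal.ofReal (2 ^ n * Real.exp (-(t / 2))) := by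
        rw [lintegral_const_mul' _ _ ENNReal.ofReal_ne_top,
          lintegral_gammaPDF_eq_one hn0 (by norm_num), mul_one]

theorem noiseLaw_tail_le {n : ℕ} (hn : n ≠ 0) {t : ℝ} :
    noiseLaw n {b | t < ‖b‖} ≤ ENNReal.ofReal (2 ^ n * Real.exp (-(t / 2))) := by
  have := isProbabilityMeasure_uniformSphere hn
  have hmeas : MeasurableSet {b : Feature n | t < ‖b‖} :=
    measurableSet_lt measurable_const measurable_norm
  have hpre : (fun p : ℝ × Metric.sphere (0 : Feature n) 1 => p.1 • (p.2 : Feature n)) ⁻¹'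
      {b | t < ‖b‖} = {r : ℝ | t < |r|} ×ˢ Set.univ := by
    ext p
    simp [norm_smul]
  rw [noiseLaw, Measure.map_apply (measurable_polar n) hmeas, hpre, Measure.prod_prod,
    measure_univ, mul_one]
  exact gammaMeasure_tail_le hn

variable {m : ℕ}

theorem reportCount_eq_sum (c : Fin m → ℝ) (s : ℝ) :
    (reportCount c s : ℝ) = ∑ i, (Set.Iic s).indicator 1 (c i) := by
  simp [reportCount, Set.indicator_apply]

theorem exp_reportCount (c : Fin m → ℝ) (s t : ℝ) :
    Real.exp (t * reportCount c s) =
      ∏ i, (1 + (Set.Iic s).indicator (fun _ => Real.exp t - 1) (c i)) := by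
  rw [reportCount_eq_sum, Finset.mul_sum, Real.exp_sum]
  refine Finset.prod_congr rfl fun i _ => ?_
  by_cases h : c i ∈ Set.Iic s <;> simp [h]

theorem integrable_exp_reportCount (ν : Measure ℝ) [IsProbabilityMeasure ν] (s t : ℝ) :
    Integrable (fun c : Fin m → ℝ => Real.exp (t * reportCount c s)) (Measure.pi fun _ => ν) := by
  simp only [exp_reportCount]
  exact Integrable.fintype_prod
    (f := fun (_ : Fin m) x => 1 + (Set.Iic s).indicator (fun _ => Real.exp t - 1) x) fun _ =>
    (integrable_const _).add ((integrable_const _).indicator measurableSet_Iic)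

/-- The moment generating function of a binomial variable is at most the one of a Poisson variable
with the same mean. -/
theorem mgf_reportCount_le (ν : Measure ℝ) [IsProbabilityMeasure ν] (s t : ℝ) :
    mgf (fun c : Fin m → ℝ => (reportCount c s : ℝ)) (Measure.pi fun _ => ν) t ≤
      Real.exp (m * ν.real (Set.Iic s) * (Real.exp t - 1)) := by
  have h1 : ∫ x, (1 + (Set.Iic s).indicator (fun _ => Real.exp t - 1) x) ∂ν =
      1 + ν.real (Set.Iic s) * (Real.exp t - 1) := by
    rw [integral_add (integrable_const _) ((integrable_const _).indicator measurableSet_Iic),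
      integral_indicator measurableSet_Iic]
    simp
  have h2 : 0 ≤ 1 + ν.real (Set.Iic s) * (Real.exp t - 1) := by
    have : ν.real (Set.Iic s) ≤ 1 := measureReal_le_one
    have h0 : 0 ≤ ν.real (Set.Iic s) := measureReal_nonneg
    nlinarith [Real.exp_pos t]
  unfold mgf
  simp only [exp_reportCount]
  rw [integral_fintype_prod_eq_pow
    (fun x => 1 + (Set.Iic s).indicator (fun _ => Real.exp t - 1) x), h1, Fintype.card_fin]
  calc (1 + ν.real (Set.Iic s) * (Real.exp t - 1)) ^ m
      ≤ Real.exp (ν.real (Set.Iic s) * (Real.exp t - 1)) ^ m := by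
        gcongr
        linarith [Real.add_one_le_exp (ν.real (Set.Iic s) * (Real.exp t - 1))]
    _ = _ := by rw [← Real.exp_nat_mul]; ring_nf

theorem reportCount_lower_tail (ν : Measure ℝ) [IsProbabilityMeasure ν] {s x y : ℝ}
    (hy : y ≤ m * ν.real (Set.Iic s)) :
    (Measure.pi fun _ : Fin m => ν) {c | (reportCount c s : ℝ) ≤ x} ≤
      ENNReal.ofReal (Real.exp (x - y / 2)) := by
  rw [← ENNReal.ofReal_toReal (measure_ne_top _ _)]
  refine ENNReal.ofReal_le_ofReal ((measure_le_le_exp_mul_mgf (t := -1) x (by norm_num)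
    (integrable_exp_reportCount ν s (-1))).trans ?_)
  have h0 : (0 : ℝ) ≤ m * ν.real (Set.Iic s) := by positivity
  have he : Real.exp (-1) - 1 ≤ -(1 / 2) := by
    have := Real.exp_one_gt_d9
    have h2 : Real.exp (-1) ≤ 1 / 2 := by
      rw [Real.exp_neg, ← one_div]
      exact one_div_le_one_div_of_le two_pos (by linarith)
    linarith
  calc Real.exp (- -1 * x) * mgf (fun c : Fin m → ℝ => (reportCount c s : ℝ))
        (Measure.pi fun _ => ν) (-1)
      ≤ Real.exp (- -1 * x) * Real.exp (m * ν.real (Set.Iic s) * (Real.exp (-1) - 1)) := by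
        gcongr; exact mgf_reportCount_le ν s (-1)
    _ ≤ Real.exp (x - y / 2) := by
        rw [← Real.exp_add]
        refine Real.exp_le_exp.2 ?_
        nlinarith

theorem reportCount_upper_tail (ν : Measure ℝ) [IsProbabilityMeasure ν] {s x y : ℝ}
    (hy : m * ν.real (Set.Iic s) ≤ y) :
    (Measure.pi fun _ : Fin m => ν) {c | x ≤ (reportCount c s : ℝ)} ≤
      ENNReal.ofReal (Real.exp (2 * y - x)) := by
  rw [← ENNReal.ofReal_toReal (measure_ne_top _ _)]
  refine ENNReal.ofReal_le_ofReal ((measure_ge_le_exp_mul_mgf (t := 1) x zero_le_one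
    (integrable_exp_reportCount ν s 1)).trans ?_)
  have h0 : (0 : ℝ) ≤ m * ν.real (Set.Iic s) := by positivity
  have he : Real.exp 1 - 1 ≤ 2 := by
    have := Real.exp_one_lt_d9
    linarith
  calc Real.exp (-1 * x) * mgf (fun c : Fin m → ℝ => (reportCount c s : ℝ))
        (Measure.pi fun _ => ν) 1
      ≤ Real.exp (-1 * x) * Real.exp (m * ν.real (Set.Iic s) * (Real.exp 1 - 1)) := by
        gcongr; exact mgf_reportCount_le ν s 1
    _ ≤ Real.exp (2 * y - x) := by
        rw [← Real.exp_add]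
        refine Real.exp_le_exp.2 ?_
        nlinarith

/-- Hoeffding's inequality for the weighted empirical loss. -/
theorem weighted_risk_tail {n : ℕ} {𝒟 : Measure (DataPoint n)} [IsProbabilityMeasure 𝒟]
    (h𝒟 : IsDataLaw 𝒟) {a : Fin m → ℝ} (hsum : ∑ i, a i = 1) {A β τ : ℝ} (hA : 0 < A)
    (hnorm : √(∑ i, a i ^ 2) ≤ A) (hτ : 0 ≤ τ) {w : Feature n} (hw : ‖w‖ ≤ β) :
    (Measure.pi fun _ : Fin m => 𝒟)
        {D | ∑ i, a i * logisticLoss ((D i).2 * ⟪w, (D i).1⟫) + τ ≤ risk 𝒟 w} ≤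
      ENNReal.ofReal (Real.exp (-(2 * τ ^ 2 / (A * logisticLoss (-β)) ^ 2))) := by
  set K := logisticLoss (-β) with hK
  have hβ : 0 ≤ β := (norm_nonneg w).trans hw
  have hK1 : 1 ≤ K := one_le_logisticLoss (by linarith)
  have hm := measurable_logisticLoss_margin w
  set X : Fin m → DataPoint n → ℝ :=
    fun i z => -(a i) * (logisticLoss (z.2 * ⟪w, z.1⟫) - risk 𝒟 w) with hX
  have hind : iIndepFun (fun i (D : Fin m → DataPoint n) => X i (D i))
      (Measure.pi fun _ => 𝒟) :=
    iIndepFun_pi fun i => ((hm.sub_const _).const_mul _).aemeasurable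
  have hsub : HasSubgaussianMGF
      (fun z : DataPoint n => logisticLoss (z.2 * ⟪w, z.1⟫) - risk 𝒟 w)
      ((‖K - 0‖₊ / 2) ^ 2) 𝒟 :=
    hasSubgaussianMGF_of_mem_Icc hm.aemeasurable
      (h𝒟.mono fun _ hz => logisticLoss_margin_mem hz hw)
  have hsubX : ∀ i ∈ Finset.univ, HasSubgaussianMGF
      (fun D : Fin m → DataPoint n => X i (D i))
      (‖a i‖₊ ^ 2 * (‖K - 0‖₊ / 2) ^ 2) (Measure.pi fun _ => 𝒟) := by
    intro i _
    refine HasSubgaussianMGF.of_map (Y := fun D : Fin m → DataPoint n => D i) (X := X i)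
      (measurable_pi_apply i).aemeasurable ?_
    rw [(measurePreserving_eval (fun _ : Fin m => 𝒟) i).map_eq]
    have hpar : (‖a i‖₊ ^ 2 : NNReal) = ⟨(-(a i)) ^ 2, sq_nonneg _⟩ := NNReal.eq (by
      rw [NNReal.coe_pow, coe_nnnorm, Real.norm_eq_abs, sq_abs]
      exact (neg_sq _).symm)
    rw [hpar]
    exact hsub.const_mul _
  have hhoeff := HasSubgaussianMGF.measure_sum_ge_le_of_iIndepFun hind hsubX hτ
  rw [← ENNReal.ofReal_toReal (measure_ne_top _ _)]
  refine ENNReal.ofReal_le_ofReal ?_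
  have hset : {D : Fin m → DataPoint n |
      ∑ i, a i * logisticLoss ((D i).2 * ⟪w, (D i).1⟫) + τ ≤ risk 𝒟 w} =
      {D | τ ≤ ∑ i, X i (D i)} := by
    ext D
    have : ∑ i, X i (D i) =
        risk 𝒟 w - ∑ i, a i * logisticLoss ((D i).2 * ⟪w, (D i).1⟫) := by
      simp only [hX, mul_sub, neg_mul, Finset.sum_sub_distrib, Finset.sum_neg_distrib]
      rw [← Finset.sum_mul, hsum]
      ring
    simp only [Set.mem_ofPred_eq, this]
    constructor <;> intro h <;> linarith
  rw [hset]
  refine hhoeff.trans (Real.exp_le_exp.2 ?_)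
  have hc : ((∑ i, ‖a i‖₊ ^ 2 * (‖K - 0‖₊ / 2) ^ 2 : NNReal) : ℝ) =
      (∑ i, a i ^ 2) * (K / 2) ^ 2 := by
    have hKn : |K| = K := abs_of_nonneg (by linarith)
    rw [NNReal.coe_sum, Finset.sum_mul]
    refine Finset.sum_congr rfl fun i _ => ?_
    simp [hKn]
  rw [hc, neg_div]
  have hq : 0 < ∑ i, a i ^ 2 := by
    refine lt_of_le_of_ne (Finset.sum_nonneg fun i _ => sq_nonneg _) fun h => ?_
    have h0 : ∀ i, a i = 0 := fun i => by
      have := (Finset.sum_eq_zero_iff_of_nonneg fun i _ => sq_nonneg (a i)).1 h.symm i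
        (Finset.mem_univ i)
      exact pow_eq_zero_iff two_ne_zero |>.1 this
    simp [h0] at hsum
  have hq2 : ∑ i, a i ^ 2 ≤ A ^ 2 := (Real.sqrt_le_left hA.le).1 hnorm
  refine neg_le_neg ?_
  calc 2 * τ ^ 2 / (A * K) ^ 2 = τ ^ 2 / (2 * (A ^ 2 * (K / 2) ^ 2)) := by field_simp
    _ ≤ _ := by gcongr

end

section

/-! ### The weights of the proxy loss -/

/-- The derivative of the tail function is a telescoping sum. -/
theorem hasDerivAt_gammaTail (k : ℕ) (t : ℝ) :
    HasDerivAt (gammaTail (k + 1))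
      (-(1 / 2 * ((t / 2) ^ k / (k.factorial : ℝ) * Real.exp (-(t / 2))))) t := by
  have hexp : HasDerivAt (fun t : ℝ => Real.exp (-(t / 2)))
      (Real.exp (-(t / 2)) * -(1 / 2)) t := ((hasDerivAt_id t).div_const 2).neg.exp
  induction k with
  | zero =>
    have : gammaTail (0 + 1) = fun t : ℝ => Real.exp (-(t / 2)) := by
      funext t; simp [gammaTail]
    rw [this]
    convert hexp using 1
    simp
    ring
  | succ k ih =>
    have : gammaTail (k + 1 + 1) = fun t : ℝ => gammaTail (k + 1) t +
        (t / 2) ^ (k + 1) / ((k + 1).factorial : ℝ) * Real.exp (-(t / 2)) := by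
      funext t; simp [gammaTail, Finset.sum_range_succ]
    rw [this]
    have hpow : HasDerivAt (fun t : ℝ => (t / 2) ^ (k + 1) / ((k + 1).factorial : ℝ))
        (((k + 1 : ℕ) : ℝ) * (t / 2) ^ k * (1 / 2) / ((k + 1).factorial : ℝ)) t := by
      have := (((hasDerivAt_id t).div_const 2).pow (k + 1)).div_const ((k + 1).factorial : ℝ)
      simpa using this
    refine (ih.add (hpow.mul hexp)).congr_deriv ?_
    have h0 : (k.factorial : ℝ) ≠ 0 := by exact_mod_cast k.factorial_ne_zero
    have h1 : ((k : ℝ) + 1) ≠ 0 := by positivity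
    rw [Nat.factorial_succ]
    push_cast
    field_simp
    ring

theorem strictAntiOn_gammaTail {n : ℕ} (hn : n ≠ 0) :
    StrictAntiOn (gammaTail n) (Set.Ici 0) := by
  obtain ⟨k, rfl⟩ := Nat.exists_eq_succ_of_ne_zero hn
  refine strictAntiOn_of_deriv_neg (convex_Ici 0)
    (fun t _ => (hasDerivAt_gammaTail k t).continuousAt.continuousWithinAt) fun t ht => ?_
  rw [interior_Ici] at ht
  have ht0 : 0 < t := ht
  rw [(hasDerivAt_gammaTail k t).deriv, neg_lt_zero]
  positivity

theorem gammaTail_mem_Ioo {n : ℕ} (hn : n ≠ 0) {T : ℝ} (hT : 0 < T) :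
    0 < gammaTail n T ∧ gammaTail n T < 1 := by
  obtain ⟨k, rfl⟩ := Nat.exists_eq_succ_of_ne_zero hn
  constructor
  · exact Finset.sum_pos (fun i _ => by positivity) ⟨0, by simp⟩
  · have h0 : gammaTail (k + 1) 0 = 1 := by
      simp [gammaTail, Finset.sum_range_succ']
    rw [← h0]
    exact strictAntiOn_gammaTail hn Set.self_mem_Ici hT.le hT

theorem gammaTailInv_gammaTail {n : ℕ} (hn : n ≠ 0) {T : ℝ} (hT : 0 ≤ T) :
    gammaTailInv n (gammaTail n T) = T :=
  (strictAntiOn_gammaTail hn).injOn.leftInvOn_invFunOn hT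

theorem muParam_pos {δ β : ℝ} (hδ : 0 ≤ Real.log (1 / δ)) (hβ : 0 < β) : 0 < muParam δ β := by
  have := log_two_pos
  have : 0 ≤ Real.logb 2 (1 + Real.exp β) :=
    Real.logb_nonneg one_lt_two (by linarith [Real.exp_pos β])
  unfold muParam
  positivity

theorem exists_sigmaParam_eq {n : ℕ} (hn : n ≠ 0) {δ β : ℝ} (hδ : 0 ≤ Real.log (1 / δ))
    (hβ : 0 < β) :
    ∃ δ', 0 < δ' ∧ δ' < 1 ∧ sigmaParam n δ δ' β = muParam δ β ^ 2 := by
  have hμ := muParam_pos hδ hβ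
  set T := muParam δ β ^ 2 / (2 * β * (6 * Real.log (1 / δ) / √2 + 1)) with hT
  have hT0 : 0 < T := by positivity
  refine ⟨gammaTail n T, (gammaTail_mem_Ioo hn hT0).1, (gammaTail_mem_Ioo hn hT0).2, ?_⟩
  have : 6 * Real.log (1 / δ) / √2 + 1 ≠ 0 := by positivity
  rw [sigmaParam, gammaTailInv_gammaTail hn hT0.le, hT]
  field_simp

theorem muParam_exp_neg (x β : ℝ) :
    muParam (Real.exp (-x)) β = 3 * x / √2 * logisticLoss (-β) + β / Real.log 2 := by
  rw [muParam, one_div, ← Real.exp_neg, neg_neg, Real.log_exp, logisticLoss, neg_neg]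

/-! ### The outcome outside the exceptional event -/

variable {f : ℝ → ℝ} {μ γ β ρ ν c₁ r₁ r₂ h : ℝ} {n m : ℕ}

/-- The constant `Q` in the bound `Q μ / h` on the sum of the payments, times `γ`. -/
noncomputable def paymentConst (γ r₁ r₂ : ℝ) : ℝ :=
  2 * lossConst γ r₁ r₂ ^ 3 * √(48 * r₂ / γ)

theorem outcome_of_typical {𝒟 : Measure (DataPoint n)} [IsProbabilityMeasure 𝒟]
    (h𝒟 : IsDataLaw 𝒟) (hf : IsCostDensity f) (hreg : RegularVirtualCost f) (h₁ : 0 < r₁)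
    (h₂ : 0 < r₂) (hb : ∀ c ∈ Set.Icc (0 : ℝ) c₁, r₁ ≤ f c ∧ f c ≤ r₂) (hγ : 0 < γ)
    (hβ : 0 < β) (hρ : 0 < ρ) (hν : 0 < ν) (hμ : 0 < μ) (hh : 0 < h) (hc₁ : 1 / h ^ 2 ≤ c₁)
    (hZ : 2 * lossConst γ r₁ r₂ ^ 2 / (γ * h ^ 2) ≤ c₁)
    (hμ₁ : 32 * lossConst γ r₁ r₂ ≤ μ)
    (hμ₂ : 2 * ν * lossConst γ r₁ r₂ / (β * μ) < ρ * logisticSlope β)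
    (hμ₃ : paymentConst γ r₁ r₂ * (μ / h) ≤ 3 * ν / 8)
    {alloc : (Fin m → ℝ) → (Fin m → ℝ) × ℝ} (halloc : IsStepOneRule f μ (μ ^ 2) γ alloc)
    {t : (Fin m → ℝ) → Fin m → ℝ} (ht : IsPaymentRule alloc t)
    {D : Fin m → DataPoint n} {c : Fin m → ℝ} {b : Feature n}
    (hD : ∀ i, IsValidPoint (D i))
    (hsep : ∃ v : Feature n, ‖v‖ = 1 ∧ ∀ i, ρ ≤ ⟪v, (D i).1⟫ * (D i).2)
    (hc : TypicalReports f γ r₁ r₂ h c) (hbn : ‖b‖ ≤ ν * h / β)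
    {T : Set (Feature n)}
    (hT : ∀ w : Feature n, ‖w‖ ≤ β → ∃ u ∈ T, ‖u - w‖ / Real.log 2 ≤ ν / 16)
    (hdev : ∀ u ∈ T, ∑ i, (alloc c).1 i = 1 →
      √(∑ i, (alloc c).1 i ^ 2) ≤ lossConst γ r₁ r₂ / h →
      risk 𝒟 u ≤ ∑ i, (alloc c).1 i * logisticLoss ((D i).2 * ⟪u, (D i).1⟫) + ν / 8) :
    (∃ w, IsTunedOutput D (alloc c) b β w) ∧
      ∀ w, IsTunedOutput D (alloc c) b β w →
        buyerObjective 𝒟 γ w (t c) < logisticLoss (ρ * β) + ν := by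
  have hB : 0 < lossConst γ r₁ r₂ := one_pos.trans_le (one_le_lossConst hγ h₁ h₂.le)
  have hcard : r₁ * h ^ 2 / 4 ≤ ((Finset.univ.filter fun i => c i ≤ 1 / h ^ 2).card : ℝ) := by
    have := hc.many
    unfold reportCount at this
    linarith
  obtain ⟨hsol, hnorm, hη, -⟩ := stepOne_bounds hf h₁ hb hγ hμ hh hc₁ hc.pos hcard
    (fun i hi => (Finset.mem_filter.1 hi).2) halloc
  have hηu := eta_le_of_typical hf h₁ h₂ hγ hμ hh hc hsol hnorm
  have hpay := sum_payment_le hf hreg h₁ hb hγ hμ hh hc₁ hZ hc halloc ht hsol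
  obtain ⟨hp, hsum, hη0, -⟩ := hsol.1
  obtain ⟨v, hv, hsep⟩ := hsep
  set B := lossConst γ r₁ r₂ with hBdef
  have hbη : ‖b‖ / (alloc c).2 ≤ ν * B / (β * μ) := by
    calc ‖b‖ / (alloc c).2 ≤ (ν * h / β) / (μ * h / B) :=
          div_le_div₀ (by positivity) hbn (by positivity) hη
      _ = ν * B / (β * μ) := by field_simp
  refine ⟨exists_isTunedOutput hβ hp hsum hη0 hD hv hsep hρ ?_, fun w hw => ?_⟩
  · refine lt_of_le_of_lt ?_ hμ₂
    calc 2 * ‖b‖ / (alloc c).2 = 2 * (‖b‖ / (alloc c).2) := by ring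
      _ ≤ 2 * (ν * B / (β * μ)) := by gcongr
      _ = _ := by ring
  · obtain ⟨u, hu, huw⟩ := hT w hw.2.le
    have h1 := misclassification_le_risk h𝒟 w
    have h3 := risk_le_of_net h𝒟 hp hsum hD (hdev u hu hsum hnorm) huw
    have h4 := trainingLoss_le hβ hp hsum hη0 hv hsep hw
    have h5 : 4 * β * ‖b‖ / (alloc c).2 ≤ ν / 8 := by
      calc 4 * β * ‖b‖ / (alloc c).2 = 4 * β * (‖b‖ / (alloc c).2) := by ring
        _ ≤ 4 * β * (ν * B / (β * μ)) := by gcongr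
        _ = 4 * ν * B / μ := by field_simp
        _ ≤ ν / 8 := by rw [div_le_div_iff₀ hμ (by norm_num)]; nlinarith
    have h6 : γ * ∑ i, t c i ≤ 3 * ν / 8 := by
      refine le_trans ?_ hμ₃
      calc γ * ∑ i, t c i
          ≤ γ * (2 * B ^ 2 / (γ * h ^ 2) * (μ * h * (B * √(48 * r₂ / γ)))) := by
            gcongr
            exact hpay.trans (by gcongr)
        _ = paymentConst γ r₁ r₂ * (μ / h) := by
            rw [paymentConst, ← hBdef]; field_simp
    unfold buyerObjective
    linarith

/-! ### The probability of the exceptional event -/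

theorem prod_preimage_fst {α α' : Type*} [MeasurableSpace α] [MeasurableSpace α']
    (P : Measure α) (P' : Measure α') [IsProbabilityMeasure P] [IsProbabilityMeasure P']
    (s : Set α) : P.prod P' (Prod.fst ⁻¹' s) = P s := by
  rw [← Set.prod_univ, Measure.prod_prod, measure_univ, mul_one]

theorem prod_preimage_snd {α α' : Type*} [MeasurableSpace α] [MeasurableSpace α']
    (P : Measure α) (P' : Measure α') [IsProbabilityMeasure P] [IsProbabilityMeasure P']
    (s : Set α') : P.prod P' (Prod.snd ⁻¹' s) = P' s := by
  rw [← Set.univ_prod, Measure.prod_prod, measure_univ, one_mul]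

theorem prod_le_of_slices {α α' : Type*} [MeasurableSpace α] [MeasurableSpace α']
    (P : Measure α) (P' : Measure α') [IsProbabilityMeasure P] [IsProbabilityMeasure P']
    {s : Set (α × α')} (hs : MeasurableSet s) {C : ENNReal}
    (h : ∀ y, P {x | (x, y) ∈ s} ≤ C) : P.prod P' s ≤ C := by
  rw [Measure.prod_apply_symm hs]
  calc ∫⁻ y, P ((fun x => (x, y)) ⁻¹' s) ∂P' ≤ ∫⁻ _, C ∂P' := lintegral_mono fun y => h y
    _ = C := by rw [lintegral_const, measure_univ, mul_one]

theorem ae_typical_signs (hf : IsCostDensity f) :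
    ∀ᵐ c ∂(Measure.pi fun _ : Fin m => costLaw f), ∀ i, 0 < c i ∧ f (c i) ≠ 0 := by
  have := isProbabilityMeasure_costLaw hf
  rw [ae_all_iff]
  exact fun i => (Measure.quasiMeasurePreserving_eval (μ := fun _ => costLaw f) i).ae (ae_costLaw hf)

theorem ae_validPoint {𝒟 : Measure (DataPoint n)} [IsProbabilityMeasure 𝒟] (h𝒟 : IsDataLaw 𝒟) :
    ∀ᵐ D ∂(Measure.pi fun _ : Fin m => 𝒟), ∀ i, IsValidPoint (D i) := by
  rw [ae_all_iff]
  exact fun i => (Measure.quasiMeasurePreserving_eval (μ := fun _ => 𝒟) i).ae h𝒟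

/-- Weighted empirical losses deviate rarely: condition on the reports, which determine the
weights. -/
theorem deviation_measure_le {𝒟 : Measure (DataPoint n)} [IsProbabilityMeasure 𝒟]
    (h𝒟 : IsDataLaw 𝒟) (hn : n ≠ 0) (hf : IsCostDensity f)
    {alloc : (Fin m → ℝ) → (Fin m → ℝ) × ℝ} (halloc : Measurable alloc) {A τ : ℝ} (hA : 0 < A)
    (hτ : 0 ≤ τ) {u : Feature n} (hu : ‖u‖ ≤ β) :
    sampleLaw 𝒟 f m {ω | (∑ i, (alloc ω.2.1).1 i = 1 ∧ √(∑ i, (alloc ω.2.1).1 i ^ 2) ≤ A) ∧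
      ∑ i, (alloc ω.2.1).1 i * logisticLoss ((ω.1 i).2 * ⟪u, (ω.1 i).1⟫) + τ ≤ risk 𝒟 u} ≤
      ENNReal.ofReal (Real.exp (-(2 * τ ^ 2 / (A * logisticLoss (-β)) ^ 2))) := by
  have := isProbabilityMeasure_costLaw hf
  have := isProbabilityMeasure_noiseLaw hn
  have ha : ∀ i, Measurable fun ω : (Fin m → DataPoint n) × (Fin m → ℝ) × Feature n =>
      (alloc ω.2.1).1 i := fun i =>
    (measurable_pi_apply i).comp (measurable_fst.comp (halloc.comp (measurable_fst.comp
      measurable_snd)))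
  have hl : ∀ i, Measurable fun ω : (Fin m → DataPoint n) × (Fin m → ℝ) × Feature n =>
      logisticLoss ((ω.1 i).2 * ⟪u, (ω.1 i).1⟫) := fun i =>
    (measurable_logisticLoss_margin u).comp ((measurable_pi_apply i).comp measurable_fst)
  refine prod_le_of_slices _ _ ?_ fun y => ?_
  · refine MeasurableSet.inter (MeasurableSet.inter ?_ ?_) ?_
    · exact measurableSet_eq_fun (Finset.measurable_sum _ fun i _ => ha i) measurable_const
    · exact measurableSet_le
        (Finset.measurable_sum _ fun i _ => (ha i).pow_const 2).sqrt measurable_const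
    · exact measurableSet_le ((Finset.measurable_sum _ fun i _ => (ha i).mul (hl i)).add_const _)
        measurable_const
  · by_cases hy : ∑ i, (alloc y.1).1 i = 1 ∧ √(∑ i, (alloc y.1).1 i ^ 2) ≤ A
    · refine le_trans (measure_mono fun D hD => ?_) (weighted_risk_tail h𝒟 hy.1 hA hy.2 hτ hu)
      exact hD.2
    · have : {D : Fin m → DataPoint n | (D, y) ∈ {ω : (Fin m → DataPoint n) × (Fin m → ℝ) ×
          Feature n | (∑ i, (alloc ω.2.1).1 i = 1 ∧ √(∑ i, (alloc ω.2.1).1 i ^ 2) ≤ A) ∧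
          ∑ i, (alloc ω.2.1).1 i * logisticLoss ((ω.1 i).2 * ⟪u, (ω.1 i).1⟫) + τ ≤
            risk 𝒟 u}} = ∅ :=
        Set.eq_empty_of_forall_notMem fun D hD => hy hD.1
      rw [this, measure_empty]
      exact zero_le

/-- `exp (-κ h ^ 2)` is negligible against `exp (-θ h)`, with an explicit constant. -/
theorem exp_neg_sq_le {κ : ℝ} (hκ : 0 < κ) (θ h : ℝ) :
    Real.exp (-(κ * h ^ 2)) ≤ Real.exp (θ ^ 2 / (4 * κ)) * Real.exp (-(θ * h)) := by
  rw [← Real.exp_add]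
  refine Real.exp_le_exp.2 ?_
  have h1 : θ ^ 2 / (4 * κ) - θ * h + κ * h ^ 2 = (θ - 2 * κ * h) ^ 2 / (4 * κ) := by
    field_simp
    ring
  have h2 : 0 ≤ (θ - 2 * κ * h) ^ 2 / (4 * κ) := by positivity
  linarith

/-- The constant in front of the exponential, for a net with `N` points and
`θ = ν / (2 β)`. -/
noncomputable def exceptionConst (γ β ν r₁ r₂ : ℝ) (n N : ℕ) : ℝ :=
  Real.exp 1 * Real.exp ((ν / (2 * β)) ^ 2 / (4 * (r₁ / 4))) +
    Real.exp ((ν / (2 * β)) ^ 2 / (4 * (1 / (12 * lossConst γ r₁ r₂ ^ 2)))) + 2 ^ n +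
    N * Real.exp ((ν / (2 * β)) ^ 2 /
      (4 * (2 * (ν / 8) ^ 2 / (lossConst γ r₁ r₂ * logisticLoss (-β)) ^ 2)))

theorem exceptional_measure_le {𝒟 : Measure (DataPoint n)} [IsProbabilityMeasure 𝒟]
    (h𝒟 : IsDataLaw 𝒟) (hn : n ≠ 0) (hsep : SeparableWithMargin 𝒟 ρ)
    (hf : IsCostDensity f) (hreg : RegularVirtualCost f) (h₁ : 0 < r₁)
    (h₂ : 0 < r₂) (hb : ∀ c ∈ Set.Icc (0 : ℝ) c₁, r₁ ≤ f c ∧ f c ≤ r₂) (hγ : 0 < γ)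
    (hβ : 0 < β) (hρ : 0 < ρ) (hν : 0 < ν) (hμ : 0 < μ) (hh : 0 < h) (hm : h ^ 4 = m)
    (hc₁ : 1 / h ^ 2 ≤ c₁)
    (hs : 1 / (12 * lossConst γ r₁ r₂ ^ 2 * r₂ * h ^ 2) ≤ c₁)
    (hZ : 2 * lossConst γ r₁ r₂ ^ 2 / (γ * h ^ 2) ≤ c₁)
    (hμ₁ : 32 * lossConst γ r₁ r₂ ≤ μ)
    (hμ₂ : 2 * ν * lossConst γ r₁ r₂ / (β * μ) < ρ * logisticSlope β)
    (hμ₃ : paymentConst γ r₁ r₂ * (μ / h) ≤ 3 * ν / 8)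
    {alloc : (Fin m → ℝ) → (Fin m → ℝ) × ℝ} (halloc : IsStepOneRule f μ (μ ^ 2) γ alloc)
    {t : (Fin m → ℝ) → Fin m → ℝ} (ht : IsPaymentRule alloc t)
    {T : Finset (Feature n)} (hTβ : ∀ u ∈ T, ‖u‖ ≤ β)
    (hT : ∀ w : Feature n, ‖w‖ ≤ β → ∃ u ∈ T, ‖u - w‖ / Real.log 2 ≤ ν / 16) :
    sampleLaw 𝒟 f m
        {ω | ¬ ((∃ w, IsTunedOutput ω.1 (alloc ω.2.1) ω.2.2 β w) ∧
          ∀ w, IsTunedOutput ω.1 (alloc ω.2.1) ω.2.2 β w →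
            buyerObjective 𝒟 γ w (t ω.2.1) < logisticLoss (ρ * β) + ν)} ≤
      ENNReal.ofReal (exceptionConst γ β ν r₁ r₂ n T.card *
        Real.exp (-(ν / (2 * β) * h))) := by
  have := isProbabilityMeasure_costLaw hf
  have := isProbabilityMeasure_noiseLaw hn
  have hB : 0 < lossConst γ r₁ r₂ := one_pos.trans_le (one_le_lossConst hγ h₁ h₂.le)
  have hK : 0 < logisticLoss (-β) := one_pos.trans_le (one_le_logisticLoss (by linarith))
  set B := lossConst γ r₁ r₂ with hBdef
  set K := logisticLoss (-β) with hKdef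
  set θ := ν / (2 * β) with hθ
  set s := 1 / (12 * B ^ 2 * r₂ * h ^ 2) with hsdef
  let Ω := (Fin m → DataPoint n) × (Fin m → ℝ) × Feature n
  let A₁ : Set Ω := Prod.fst ⁻¹' {D | ¬ ((∀ i, IsValidPoint (D i)) ∧
    ∃ v : Feature n, ‖v‖ = 1 ∧ ∀ i, ρ ≤ ⟪v, (D i).1⟫ * (D i).2)}
  let A₂ : Set Ω := Prod.snd ⁻¹' (Prod.fst ⁻¹' {c | ¬ ∀ i, 0 < c i ∧ f (c i) ≠ 0})
  let A₃ : Set Ω := Prod.snd ⁻¹' (Prod.fst ⁻¹'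
    {c | (reportCount c (1 / h ^ 2) : ℝ) ≤ r₁ * h ^ 2 / 4 + 1})
  let A₄ : Set Ω := Prod.snd ⁻¹' (Prod.fst ⁻¹' {c | h ^ 2 / (4 * B ^ 2) ≤ reportCount c s})
  let A₅ : Set Ω := Prod.snd ⁻¹' (Prod.snd ⁻¹' {b | ν * h / β < ‖b‖})
  let A₆ : Feature n → Set Ω := fun u => {ω | (∑ i, (alloc ω.2.1).1 i = 1 ∧
      √(∑ i, (alloc ω.2.1).1 i ^ 2) ≤ B / h) ∧
    ∑ i, (alloc ω.2.1).1 i * logisticLoss ((ω.1 i).2 * ⟪u, (ω.1 i).1⟫) + ν / 8 ≤ risk 𝒟 u}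
  have hsub : {ω : Ω | ¬ ((∃ w, IsTunedOutput ω.1 (alloc ω.2.1) ω.2.2 β w) ∧
      ∀ w, IsTunedOutput ω.1 (alloc ω.2.1) ω.2.2 β w →
        buyerObjective 𝒟 γ w (t ω.2.1) < logisticLoss (ρ * β) + ν)} ⊆
      A₁ ∪ (A₂ ∪ (A₃ ∪ (A₄ ∪ (A₅ ∪ ⋃ u ∈ T, A₆ u)))) := by
    intro ω hω
    by_contra hnot
    simp only [Set.mem_union, not_or, Set.mem_iUnion, not_exists] at hnot
    obtain ⟨k₁, k₂, k₃, k₄, k₅, k₆⟩ := hnot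
    replace k₁ := not_not.1 k₁
    replace k₂ := not_not.1 k₂
    refine hω (outcome_of_typical h𝒟 hf hreg h₁ h₂ hb hγ hβ hρ hν hμ hh hc₁ hZ hμ₁ hμ₂ hμ₃ halloc ht
      k₁.1 k₁.2 ⟨fun i => (k₂ i).1, fun i => (k₂ i).2, ?_, ?_⟩ (not_lt.1 k₅) (T := T) hT ?_)
    · exact (not_le.1 k₃).le
    · exact (not_le.1 k₄).le
    · intro u hu ha₁ ha₂
      by_contra! hlt
      exact k₆ u hu ⟨⟨ha₁, ha₂⟩, hlt.le⟩
  have m₁ : sampleLaw 𝒟 f m A₁ = 0 := by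
    rw [sampleLaw, prod_preimage_fst]
    exact (ae_validPoint h𝒟).and (hsep m)
  have m₂ : sampleLaw 𝒟 f m A₂ = 0 := by
    rw [sampleLaw, prod_preimage_snd, prod_preimage_fst]
    exact ae_typical_signs hf
  have m₃ : sampleLaw 𝒟 f m A₃ ≤
      ENNReal.ofReal (Real.exp 1 * Real.exp (θ ^ 2 / (4 * (r₁ / 4))) * Real.exp (-(θ * h))) := by
    rw [sampleLaw, prod_preimage_snd, prod_preimage_fst]
    refine (reportCount_lower_tail (costLaw f) (y := r₁ * h ^ 2) ?_).trans
      (ENNReal.ofReal_le_ofReal ?_)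
    · have := le_costLaw_real_Iic hf h₁.le (fun c hc => (hb c hc).1)
        (c := 1 / h ^ 2) ⟨by positivity, hc₁⟩
      calc r₁ * h ^ 2 = m * (r₁ * (1 / h ^ 2)) := by rw [← hm]; field_simp
        _ ≤ _ := by gcongr
    · have e : r₁ * h ^ 2 / 4 + 1 - r₁ * h ^ 2 / 2 = 1 + -(r₁ / 4 * h ^ 2) := by ring
      rw [e, Real.exp_add, mul_assoc]
      gcongr
      exact exp_neg_sq_le (by positivity) θ h
  have m₄ : sampleLaw 𝒟 f m A₄ ≤
      ENNReal.ofReal (Real.exp (θ ^ 2 / (4 * (1 / (12 * B ^ 2)))) * Real.exp (-(θ * h))) := by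
    rw [sampleLaw, prod_preimage_snd, prod_preimage_fst]
    refine (reportCount_upper_tail (costLaw f) (y := h ^ 2 / (12 * B ^ 2)) ?_).trans
      (ENNReal.ofReal_le_ofReal ?_)
    · have := costLaw_real_Iic_le hf (fun c hc => (hb c hc).2) (c := s) ⟨by positivity, hs⟩
      calc m * (costLaw f).real (Set.Iic s) ≤ m * (r₂ * s) := by gcongr
        _ = h ^ 2 / (12 * B ^ 2) := by rw [← hm, hsdef]; field_simp
    · have e : 2 * (h ^ 2 / (12 * B ^ 2)) - h ^ 2 / (4 * B ^ 2) =
          -(1 / (12 * B ^ 2) * h ^ 2) := by field_simp; ring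
      rw [e]
      exact exp_neg_sq_le (by positivity) θ h
  have m₅ : sampleLaw 𝒟 f m A₅ ≤ ENNReal.ofReal (2 ^ n * Real.exp (-(θ * h))) := by
    rw [sampleLaw, prod_preimage_snd, prod_preimage_snd]
    refine (noiseLaw_tail_le hn).trans (le_of_eq ?_)
    congr 4
    rw [hθ]; field_simp
  have m₆ : ∀ u ∈ T, sampleLaw 𝒟 f m (A₆ u) ≤
      ENNReal.ofReal (Real.exp (θ ^ 2 / (4 * (2 * (ν / 8) ^ 2 / (B * K) ^ 2))) *
        Real.exp (-(θ * h))) := by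
    intro u hu
    refine (deviation_measure_le h𝒟 hn hf halloc.measurable (A := B / h) (by positivity)
      (by positivity) (hTβ u hu)).trans (ENNReal.ofReal_le_ofReal ?_)
    have e : 2 * (ν / 8) ^ 2 / (B / h * logisticLoss (-β)) ^ 2 =
        2 * (ν / 8) ^ 2 / (B * K) ^ 2 * h ^ 2 := by rw [← hKdef]; field_simp
    rw [e]
    exact exp_neg_sq_le (by positivity) θ h
  have m₆' : sampleLaw 𝒟 f m (⋃ u ∈ T, A₆ u) ≤
      ENNReal.ofReal (T.card * Real.exp (θ ^ 2 / (4 * (2 * (ν / 8) ^ 2 / (B * K) ^ 2))) *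
        Real.exp (-(θ * h))) := by
    refine (measure_biUnion_finset_le T A₆).trans ((Finset.sum_le_sum m₆).trans (le_of_eq ?_))
    rw [Finset.sum_const, nsmul_eq_mul, mul_assoc, ENNReal.ofReal_mul (Nat.cast_nonneg _),
      ENNReal.ofReal_natCast]
  refine (measure_mono hsub).trans ?_
  calc sampleLaw 𝒟 f m (A₁ ∪ (A₂ ∪ (A₃ ∪ (A₄ ∪ (A₅ ∪ ⋃ u ∈ T, A₆ u)))))
      ≤ 0 + (0 + (_ + (_ + (_ + _)))) :=
        (measure_union_le _ _).trans <| add_le_add m₁.le <|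
        (measure_union_le _ _).trans <| add_le_add m₂.le <|
        (measure_union_le _ _).trans <| add_le_add m₃ <|
        (measure_union_le _ _).trans <| add_le_add m₄ <|
        (measure_union_le _ _).trans <| add_le_add m₅ m₆'
    _ = _ := by
      rw [zero_add, zero_add, ← ENNReal.ofReal_add (by positivity) (by positivity),
        ← ENNReal.ofReal_add (by positivity) (by positivity),
        ← ENNReal.ofReal_add (by positivity) (by positivity), exceptionConst]
      congr 1
      ring

end

/-! ### Asymptotics in the number of sellers -/

theorem tendsto_fourthRoot :
    Tendsto (fun m : ℕ => (m : ℝ) ^ (1 / 4 : ℝ)) atTop atTop :=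
  (tendsto_rpow_atTop (by norm_num)).comp tendsto_natCast_atTop_atTop

theorem fourthRoot_pow_four (m : ℕ) : ((m : ℝ) ^ (1 / 4 : ℝ)) ^ 4 = m := by
  rw [← Real.rpow_natCast, ← Real.rpow_mul (Nat.cast_nonneg m)]
  norm_num

theorem eventually_div_sq_le {h : ℕ → ℝ} (H : Tendsto h atTop atTop) (k : ℝ) {b : ℝ} (hb : 0 < b) :
    ∀ᶠ m in atTop, k / h m ^ 2 ≤ b :=
  (tendsto_const_nhds.div_atTop ((tendsto_pow_atTop two_ne_zero).comp H)).eventually_le_const hb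

theorem exists_finite_net {n : ℕ} {β κ : ℝ} (hκ : 0 < κ) :
    ∃ T : Finset (Feature n), (∀ u ∈ T, ‖u‖ ≤ β) ∧
      ∀ w : Feature n, ‖w‖ ≤ β → ∃ u ∈ T, ‖u - w‖ / Real.log 2 ≤ κ := by
  have hl := log_two_pos
  obtain ⟨t, ht, hfin, hcov⟩ := (isCompact_closedBall (0 : Feature n) β).finite_cover_balls
    (show 0 < κ * Real.log 2 by positivity)
  refine ⟨hfin.toFinset, fun u hu => ?_, fun w hw => ?_⟩
  · simpa using ht (hfin.mem_toFinset.1 hu)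
  · obtain ⟨u, hu, hwu⟩ := Set.mem_iUnion₂.1 (hcov (show w ∈ Metric.closedBall 0 β by simpa using hw))
    refine ⟨u, hfin.mem_toFinset.2 hu, ?_⟩
    rw [Metric.mem_ball, dist_comm, dist_eq_norm] at hwu
    rw [div_le_iff₀ hl]
    exact hwu.le

theorem dimension_ne_zero {n : ℕ} {𝒟 : Measure (DataPoint n)} [IsProbabilityMeasure 𝒟] {ρ : ℝ}
    (hsep : SeparableWithMargin 𝒟 ρ) : n ≠ 0 := by
  rintro rfl
  obtain ⟨-, v, hv, -⟩ := (hsep 0).exists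
  simp [Subsingleton.elim v 0] at hv

end PrivateMarket

open PrivateMarket
theorem theorem3 (f : ℝ → ℝ) (hf : IsCostDensity f) (hreg : RegularVirtualCost f)
    (hpos : PositiveBoundedNearZero f) (γ β : ℝ) (hγ : 0 < γ) (hβ : 0 < β) :
    ∃ E > 0, ∀ (n : ℕ) (𝒟 : Measure (DataPoint n)) (ρ : ℝ), IsProbabilityMeasure 𝒟 →
      IsDataLaw 𝒟 → 0 < ρ → SeparableWithMargin 𝒟 ρ → ∀ ν > 0,
      ∃ δ δ' : ℕ → ℝ,
        (∀ m : ℕ, 1 ≤ m →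
          δ m = Real.exp (-(E * ν * (m : ℝ) ^ (1 / 4 : ℝ))) ∧ 0 < δ' m ∧ δ' m < 1 ∧
          sigmaParam n (δ m) (δ' m) β = muParam (δ m) β ^ 2) ∧
        ∃ (r : ℕ → ℝ) (C : ℝ), Tendsto r atTop (𝓝 0) ∧
          ∀ m : ℕ, 1 ≤ m →
          ∀ alloc : (Fin m → ℝ) → (Fin m → ℝ) × ℝ,
            IsStepOneRule f (muParam (δ m) β) (sigmaParam n (δ m) (δ' m) β) γ alloc →
          ∀ t : (Fin m → ℝ) → Fin m → ℝ, IsPaymentRule alloc t →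
            sampleLaw 𝒟 f m
              {ω | ¬ ((∃ w, IsTunedOutput ω.1 (alloc ω.2.1) ω.2.2 β w) ∧
                ∀ w, IsTunedOutput ω.1 (alloc ω.2.1) ω.2.2 β w →
                  buyerObjective 𝒟 γ w (t ω.2.1) <
                    Real.logb 2 (1 + Real.exp (-(ρ * β))) + ν + r m)} ≤
            ENNReal.ofReal (C * Real.exp (-(ν * (m : ℝ) ^ (1 / 4 : ℝ) / (2 * β)))) := by
  obtain ⟨c₁, hc₁, r₁, h₁, r₂, hb⟩ := hpos
  have h₂ : 0 < r₂ := by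
    have := hb 0 ⟨le_rfl, hc₁.le⟩
    linarith
  have hl := log_two_pos
  have hB : 0 < lossConst γ r₁ r₂ := one_pos.trans_le (one_le_lossConst hγ h₁ h₂.le)
  have hQ : 0 ≤ paymentConst γ r₁ r₂ := by unfold paymentConst; positivity
  have hK : 0 < logisticLoss (-β) := one_pos.trans_le (one_le_logisticLoss (by linarith))
  set Q := paymentConst γ r₁ r₂ with hQdef
  set K := logisticLoss (-β) with hKdef
  -- The payments are asymptotically at most `Q * (3 * E * K / √2) * ν ≤ ν / 4`.
  refine ⟨1 / (12 * K * (Q + 1)), by positivity, fun n 𝒟 ρ _ h𝒟 hρ hsep ν hν => ?_⟩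
  set E := 1 / (12 * K * (Q + 1)) with hE
  have hE0 : 0 < E := by positivity
  have hn := dimension_ne_zero hsep
  set h : ℕ → ℝ := fun m => (m : ℝ) ^ (1 / 4 : ℝ) with hh
  have hhnn : ∀ m, 0 ≤ h m := fun m => by positivity
  have H : Tendsto h atTop atTop := tendsto_fourthRoot
  have hlog : ∀ m, 0 ≤ Real.log (1 / Real.exp (-(E * ν * h m))) := fun m => by
    rw [one_div, ← Real.exp_neg, neg_neg, Real.log_exp]
    have := hhnn m
    positivity
  choose δ' hδ' using fun m => exists_sigmaParam_eq (n := n) hn (hlog m) hβ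
  refine ⟨fun m => Real.exp (-(E * ν * h m)), δ', fun m _ => ⟨rfl, hδ' m⟩, fun _ => 0, ?_⟩
  set μ : ℕ → ℝ := fun m => muParam (Real.exp (-(E * ν * h m))) β with hμ
  have hμpos : ∀ m, 0 < μ m := fun m => muParam_pos (hlog m) hβ
  have hμeq : ∀ m, μ m = 3 * E * K / √2 * ν * h m + β / Real.log 2 := fun m => by
    simp only [hμ, muParam_exp_neg]
    ring
  have Hμ : Tendsto μ atTop atTop := by
    simp only [funext hμeq]
    exact tendsto_atTop_add_const_right _ _ (H.const_mul_atTop (by positivity))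
  have hpay : ∀ᶠ m in atTop, Q * (μ m / h m) ≤ 3 * ν / 8 := by
    have hlim : Tendsto (fun m => Q * (β / Real.log 2) / h m) atTop (𝓝 0) :=
      tendsto_const_nhds.div_atTop H
    filter_upwards [hlim.eventually_le_const (show 0 < ν / 8 by positivity),
      H.eventually_gt_atTop 0] with m hm hm0
    have h2 : (1 : ℝ) ≤ √2 := Real.one_le_sqrt.2 one_le_two
    have h3 : Q * (3 * E * K / √2) ≤ 1 / 4 := by
      calc Q * (3 * E * K / √2) ≤ Q * (3 * E * K / 1) := by gcongr
        _ = 1 / 4 * (Q / (Q + 1)) := by rw [hE]; field_simp; ring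
        _ ≤ 1 / 4 * 1 := by gcongr; rw [div_le_one (by positivity)]; linarith
        _ = 1 / 4 := mul_one _
    have e : Q * (μ m / h m) = Q * (3 * E * K / √2) * ν + Q * (β / Real.log 2) / h m := by
      rw [hμeq]; field_simp
    rw [e]
    nlinarith
  have hslope : 0 < ρ * logisticSlope β := by unfold logisticSlope; positivity
  have hdir : ∀ᶠ m in atTop,
      2 * ν * lossConst γ r₁ r₂ / (β * μ m) < ρ * logisticSlope β :=
    (tendsto_const_nhds.div_atTop (Hμ.const_mul_atTop hβ)).eventually_lt_const hslope
  obtain ⟨m₀, hm₀⟩ := eventually_atTop.1 <| (H.eventually_gt_atTop 0).and <|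
    (eventually_div_sq_le H 1 hc₁).and <|
    (eventually_div_sq_le H (1 / (12 * lossConst γ r₁ r₂ ^ 2 * r₂)) hc₁).and <|
    (eventually_div_sq_le H (2 * lossConst γ r₁ r₂ ^ 2 / γ) hc₁).and <|
    (Hμ.eventually_ge_atTop (32 * lossConst γ r₁ r₂)).and <| hdir.and hpay
  obtain ⟨T, hTβ, hT⟩ := exists_finite_net (n := n) (β := β) (κ := ν / 16) (by positivity)
  have hexc : 0 ≤ exceptionConst γ β ν r₁ r₂ n T.card := by unfold exceptionConst; positivity
  -- The second summand makes the bound trivial for `m < m₀`.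
  refine ⟨exceptionConst γ β ν r₁ r₂ n T.card + Real.exp (ν / (2 * β) * h m₀),
    tendsto_const_nhds, fun m _ alloc halloc t ht => ?_⟩
  have hexp : Real.exp (-(ν * (m : ℝ) ^ (1 / 4 : ℝ) / (2 * β))) =
      Real.exp (-(ν / (2 * β) * h m)) := by simp only [hh]; ring_nf
  rw [hexp]
  rcases lt_or_ge m m₀ with hlt | hge
  · have := isProbabilityMeasure_costLaw hf
    have := isProbabilityMeasure_noiseLaw hn
    have hprob : IsProbabilityMeasure (sampleLaw 𝒟 f m) := by unfold sampleLaw; infer_instance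
    refine prob_le_one.trans (ENNReal.one_le_ofReal.2 ?_)
    have hmono : h m ≤ h m₀ :=
      Real.rpow_le_rpow (Nat.cast_nonneg m) (by exact_mod_cast hlt.le) (by norm_num)
    calc (1 : ℝ) ≤ Real.exp (ν / (2 * β) * h m₀) * Real.exp (-(ν / (2 * β) * h m)) := by
          rw [← Real.exp_add, ← Real.exp_zero]
          refine Real.exp_le_exp.2 ?_
          have : ν / (2 * β) * h m ≤ ν / (2 * β) * h m₀ := by gcongr
          linarith
      _ ≤ _ := by gcongr; linarith
  · obtain ⟨g₀, g₁, g₂, g₃, g₄, g₅, g₆⟩ := hm₀ m hge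
    rw [(hδ' m).2.2] at halloc
    rw [div_div] at g₂ g₃
    have hmain := exceptional_measure_le h𝒟 hn hsep hf hreg h₁ h₂ hb hγ hβ hρ hν (hμpos m) g₀
      (fourthRoot_pow_four m) g₁ g₂ g₃ g₄ g₅ g₆ halloc ht hTβ hT
    simp only [add_zero]
    refine hmain.trans (ENNReal.ofReal_le_ofReal ?_)
    gcongr
    exact le_add_of_nonneg_right (Real.exp_pos _).le
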